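/- Black box model. Let $G$ be a finite group. A black box group $\mathbf{X}$ encrypting $G$ is an oracle whose elements are $0$–$1$ strings of one fixed length, each string $x\in\mathbf{X}$ encrypting an element $\pi(x)\in G$ (different strings may encrypt the same element, and $\pi$ is not available to algorithms). On request it produces independent random strings such that every $g\in G$ is encrypted with probability between $\frac{1}{2|G|}$ and $\frac{3}{2|G|}$ (in particular, the uniform distribution is allowed); it produces a string encrypting the product of two elements, or the inverse of an element, given by strings; and it decides whether two strings encrypt the same element. Let $\mu$ be an upper bound for the time of one product, inverse or equality query, and $\xi$ an upper bound for the time of producing one random string. A global exponent of $\mathbf{X}$ is an integer $E\ge 1$ with $\pi(x)^E=1$ for all $x\in \mathbf{X}$. Theorem. There are a single randomized (Monte Carlo) black box algorithm $\mathcal{A}$ and a single polynomial $P$ such that the following holds. Let $\mathbf{X}$ be a black box group encrypting $G=\mathrm{SO}_3(\mathbb{F})$, where $\mathbb{F}$ is a finite field of odd characteristic with $|\mathbb{F}|>9$ (neither the field nor its characteristic is given to the algorithm), and let $E$ be a global exponent of $\mathbf{X}$. Let $s,t\in\mathbf{X}$ be strings encrypting two distinct involutions of $G$, again denoted $s,t$,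 such that $st$ is not unipotent. Then there is exactly one involution $j=\mathbf{j}(s,t)$ of $G$ which commutes with $s$ and with $t$ and is different from both. On input $(E,s,t)$, the algorithm $\mathcal{A}$, which accesses $\mathbf{X}$ only through the above queries, always halts within time $P(\lfloor\log_2 E\rfloor)\cdot(1+\mu+\xi)$, where its own arithmetic on integers is charged according to bit length, and with probability at least $2/3$ its output is a string of $\mathbf{X}$ encrypting $j$. -/

import Mathlib

/-- A black box group encrypting the finite group `G`.  It operates on `0`-`1` strings of the fixed
length `len`; `Codes` is the set of strings which belong to the black box, and `proj` is the
canonical projection (which is not available to algorithms).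

* `sample` produces random strings encrypting nearly uniformly distributed elements of `G`: every
  `g : G` is produced with probability within `1 / (2 |G|)` of `1 / |G|`.  In particular `proj` is
  surjective.
* `mul` and `inv` produce a (possibly random) string encrypting the product or the inverse.
* Deciding whether two strings encrypt the same element has an answer determined by `proj`; this
  query is the instruction `BBProgram.same` below.

`opTime` and `sampleTime` are upper bounds on the time that the black box needs for one
group operation (product, inverse or equality test) and for one random string. -/
structure BlackBoxGroup (G : Type*) [Group G] [Finite G] where
  len : ℕ
  Codes : Set (Fin len → Bool)
  proj : Codes → G
  sample : PMF Codes
  sample_nearly_uniform : ∀ g : G,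
    |((sample.map proj) g).toReal - 1 / (Nat.card G : ℝ)| ≤ 1 / (2 * (Nat.card G : ℝ))
  mul : Codes → Codes → PMF Codes
  mul_spec : ∀ x y, ∀ z ∈ (mul x y).support, proj z = proj x * proj y
  inv : Codes → PMF Codes
  inv_spec : ∀ x, ∀ z ∈ (inv x).support, proj z = (proj x)⁻¹
  opTime : ℕ
  sampleTime : ℕ

/-- Arithmetic expressions over a memory of natural numbers; `get a` is the content of the memory
cell whose address is the value of `a`.  Subtraction and division are the truncated ones. -/
inductive NumExpr : Type
  | lit (n : ℕ)
  | get (a : NumExpr)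
  | add (a b : NumExpr)
  | sub (a b : NumExpr)
  | mul (a b : NumExpr)
  | div (a b : NumExpr)

namespace NumExpr

/-- The value of an expression. -/
def eval (m : ℕ → ℕ) : NumExpr → ℕ
  | lit n => n
  | get a => m (a.eval m)
  | add a b => a.eval m + b.eval m
  | sub a b => a.eval m - b.eval m
  | mul a b => a.eval m * b.eval m
  | div a b => a.eval m / b.eval m

/-- The (logarithmic) cost of evaluating an expression: reading a memory cell costs the bit lengths
of the address and of the content, an arithmetic operation costs the product of the bit lengths of
the operands. -/
def cost (m : ℕ → ℕ) : NumExpr → ℕ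
  | lit n => n.size + 1
  | get a => a.cost m + (a.eval m).size + (m (a.eval m)).size + 1
  | add a b => a.cost m + b.cost m + ((a.eval m).size + 1) * ((b.eval m).size + 1)
  | sub a b => a.cost m + b.cost m + ((a.eval m).size + 1) * ((b.eval m).size + 1)
  | mul a b => a.cost m + b.cost m + ((a.eval m).size + 1) * ((b.eval m).size + 1)
  | div a b => a.cost m + b.cost m + ((a.eval m).size + 1) * ((b.eval m).size + 1)

end NumExpr

/-- Randomized programs with access to a black box group.  A program works on a memory of natural
numbers and on a memory of strings of the black box, both addressed by natural numbers.  All the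
operands are addresses, except `e` in `set`, `branch` and `loop`. -/
inductive BBProgram : Type
  /-- do nothing -/
  | skip
  /-- `num[a] := e` -/
  | set (a e : NumExpr)
  /-- `num[a] :=` a fair random bit -/
  | flip (a : NumExpr)
  /-- `str[a] :=` a random string from the black box -/
  | sample (a : NumExpr)
  /-- `str[a] := str[b] * str[c]` -/
  | mul (a b c : NumExpr)
  /-- `str[a] := str[b]⁻¹` -/
  | inv (a b : NumExpr)
  /-- `num[a] := 1` if `str[b]` and `str[c]` encrypt the same element, and `0` otherwise -/
  | same (a b c : NumExpr)
  /-- first `p`, then `q` -/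
  | seq (p q : BBProgram)
  /-- `p` if `e ≠ 0`, and `q` otherwise -/
  | branch (e : NumExpr) (p q : BBProgram)
  /-- repeat `p` as long as `e ≠ 0` -/
  | loop (e : NumExpr) (p : BBProgram)

/-- The state of the machine: the two memories, and the time which is left until the machine
is stopped. -/
structure BBState (S : Type) where
  num : ℕ → ℕ
  str : ℕ → S
  budget : ℕ

namespace BBState

variable {S : Type}

/-- Store a number. -/
def setNum (σ : BBState S) (a v : ℕ) : BBState S := { σ with num := Function.update σ.num a v }

/-- Store a string. -/
def setStr (σ : BBState S) (a : ℕ) (x : S) : BBState S :=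
  { σ with str := Function.update σ.str a x }

/-- Spend `c` units of time and continue with `k`; the result is `none` (out of time) if less
than `c` units are left. -/
noncomputable def spend (σ : BBState S) (c : ℕ) (k : BBState S → PMF (Option (BBState S))) :
    PMF (Option (BBState S)) :=
  if c ≤ σ.budget then k { σ with budget := σ.budget - c } else PMF.pure none

/-- Sequential composition of randomized computations which may run out of time. -/
noncomputable def andThen (r : PMF (Option (BBState S)))
    (k : BBState S → PMF (Option (BBState S))) : PMF (Option (BBState S)) :=
  r.bind fun o => o.elim (PMF.pure none) k

/-- At most `n` tests of the loop with condition `e` and with the given body. -/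
noncomputable def iter (e : NumExpr) (body : BBState S → PMF (Option (BBState S))) :
    ℕ → BBState S → PMF (Option (BBState S))
  | 0, _ => PMF.pure none
  | n + 1, σ => σ.spend (e.cost σ.num) fun τ =>
      if e.eval τ.num = 0 then PMF.pure (some τ) else andThen (body τ) (iter e body n)

end BBState

namespace BlackBoxGroup

variable {G : Type*} [Group G] [Finite G]

open Classical in
/-- The random outcome of executing a program with the black box `X` from the given state:
either the final state, or `none` if the program has not halted when its time is used up.
Every test of a loop costs at least `1`, so `σ.budget + 1` tests are never
fewer than the available time allows. -/
noncomputable def exec (X : BlackBoxGroup G) :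
    BBProgram → BBState X.Codes → PMF (Option (BBState X.Codes))
  | .skip, σ => σ.spend 1 fun τ => PMF.pure (some τ)
  | .set a e, σ =>
      σ.spend (a.cost σ.num + e.cost σ.num + (a.eval σ.num).size + (e.eval σ.num).size + 1)
        fun τ => PMF.pure (some (τ.setNum (a.eval τ.num) (e.eval τ.num)))
  | .flip a, σ => σ.spend (a.cost σ.num + (a.eval σ.num).size + 1) fun τ =>
      (PMF.uniformOfFintype Bool).map fun b => some (τ.setNum (a.eval τ.num) b.toNat)
  | .sample a, σ => σ.spend (a.cost σ.num + X.sampleTime) fun τ =>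
      X.sample.map fun x => some (τ.setStr (a.eval τ.num) x)
  | .mul a b c, σ => σ.spend (a.cost σ.num + b.cost σ.num + c.cost σ.num + X.opTime) fun τ =>
      (X.mul (τ.str (b.eval τ.num)) (τ.str (c.eval τ.num))).map
        fun x => some (τ.setStr (a.eval τ.num) x)
  | .inv a b, σ => σ.spend (a.cost σ.num + b.cost σ.num + X.opTime) fun τ =>
      (X.inv (τ.str (b.eval τ.num))).map fun x => some (τ.setStr (a.eval τ.num) x)
  | .same a b c, σ => σ.spend (a.cost σ.num + b.cost σ.num + c.cost σ.num + X.opTime) fun τ =>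
      PMF.pure (some (τ.setNum (a.eval τ.num)
        (if X.proj (τ.str (b.eval τ.num)) = X.proj (τ.str (c.eval τ.num)) then 1 else 0)))
  | .seq p q, σ => BBState.andThen (X.exec p σ) (X.exec q)
  | .branch e p q, σ => σ.spend (e.cost σ.num) fun τ =>
      if e.eval τ.num = 0 then X.exec q τ else X.exec p τ
  | .loop e p, σ => BBState.iter e (X.exec p) (σ.budget + 1) σ

/-- The random output (the string in cell `0`) of the program `p`, run for at most `T` units of
time with the number `E` as input in cell `0` of the number memory, whose other cells
are `0`, and with the initial string memory `inp`; `none` if `p` has not halted by then. -/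
noncomputable def output (X : BlackBoxGroup G) (p : BBProgram) (E : ℕ) (inp : ℕ → X.Codes)
    (T : ℕ) : PMF (Option X.Codes) :=
  (X.exec p ⟨Function.update (fun _ => 0) 0 E, inp, T⟩).map (Option.map fun σ => σ.str 0)

end BlackBoxGroup

/-- `j` is an involution, different from `s` and from `t`, which commutes with `s` and with `t`. -/
def IsCommutingInvolution {G : Type*} [Group G] (s t j : G) : Prop :=
  orderOf j = 2 ∧ j ≠ s ∧ j ≠ t ∧ Commute j s ∧ Commute j t

/-- The group `SO₃(F)`, for the quadratic form `x² + y² + z²`. -/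
abbrev SO3 (F : Type*) [Field F] := Matrix.specialOrthogonalGroup (Fin 3) F

/-- An element of `SO₃(F)` is unipotent if `g - 1` is a nilpotent matrix. -/
def SO3.IsUnipotent {F : Type*} [Field F] (g : SO3 F) : Prop :=
  IsNilpotent ((g : Matrix (Fin 3) (Fin 3) F) - 1)

/-! ### Quadratic character sums and elements with prescribed characters. -/

section CharacterSums

variable {F : Type*} [Field F] [Fintype F] [DecidableEq F]

/-! Involutions of SO₃(F) are half-turns about nonisotropic axes. If `s` and `t` have axes u and v,
then u × v is nonisotropic because `st` is not unipotent. Since half-turns with distinct axes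
commute exactly when the axes are orthogonal, the half-turn j about u × v is the only candidate, and
it works (`isCommutingInvolution_iff`).

To reach j blindly, suppose a random g happens to be a product j n m with n² = m² = 1, n commuting
with `s`, and both tn and sm of odd order. Then g⁻¹sg = msm, and s·msm = (sm)². An exponent M with
2M - 1 the odd part of E extracts square roots of elements of odd order, so sm, hence m, is
computable. Now gm = jn conjugates `t` to ntn, so n is found in the same way, and gmn = j
(`candidate_mul`). A proposed value of j can be verified by equality queries, so a right answer is
never replaced by a wrong one. It remains to bound the success probability of a single trial below
by a constant; then a constant number of trials suffices.

A product of half-turns has odd order when a certain squared length is a nonsquare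
(`IsHalfTurn.odd_orderOf_mul`). This turns the choice of n and m into the choice of three field
elements with prescribed quadratic characters. Elementary character sums provide about q/16 choices
for n and q²/16 for m, all giving different g (`card_candidate`), while the Cayley transform gives
|SO₃(F)| ≤ 4q³ (`SO3.card_le`). The cubic sum is estimated by a symmetry instead of the Hasse bound,
which excludes the angles with squared cosine 1/2; there j = (st)². For orthogonal axes j = st. Both
values are tested before the random trials.

The machine model is handled by `Runs`, a Hoare-style predicate that carries functional correctness
and the time bound together. -/

theorem sum_quadraticChar_sub (hF : ringChar F ≠ 2) (a : F) :
    ∑ t : F, quadraticChar F (a - t) = 0 := by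
  rw [← quadraticChar_sum_zero hF]
  exact Fintype.sum_equiv (Equiv.subLeft a) _ _ fun t => rfl

theorem quadraticChar_mul_self {a : F} (ha : a ≠ 0) :
    quadraticChar F a * quadraticChar F a = 1 := by
  rw [← sq, quadraticChar_sq_one ha]

theorem quadraticChar_cases (a : F) :
    quadraticChar F a = 0 ∨ quadraticChar F a = 1 ∨ quadraticChar F a = -1 :=
  quadraticChar_isQuadratic F a

/-- The substitution t = a - (a - b)x turns the sum into χ(-1) times the Jacobi sum J(χ, χ⁻¹) =
-χ(-1). -/
theorem sum_quadraticChar_sub_mul_sub (hF : ringChar F ≠ 2) {a b : F} (hab : a ≠ b) :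
    ∑ t : F, quadraticChar F (a - t) * quadraticChar F (b - t) = -1 := by
  have hd : a - b ≠ 0 := sub_ne_zero.2 hab
  have hinv : (quadraticChar F)⁻¹ = quadraticChar F := (quadraticChar_isQuadratic F).inv
  have key := jacobiSum_nontrivial_inv (quadraticChar_ne_one hF)
  rw [hinv, jacobiSum] at key
  have e : ∑ t : F, quadraticChar F (a - t) * quadraticChar F (b - t)
      = ∑ x : F, quadraticChar F (-1) * (quadraticChar F x * quadraticChar F (1 - x)) := by
    refine (Fintype.sum_equiv ((Equiv.mulLeft₀ (a - b) hd).trans (Equiv.subLeft a)) _ _ ?_).symm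
    intro x
    have h1 : a - (((Equiv.mulLeft₀ (a - b) hd).trans (Equiv.subLeft a)) x) = (a - b) * x := by
      simp
    have h2 : b - (((Equiv.mulLeft₀ (a - b) hd).trans (Equiv.subLeft a)) x)
        = (a - b) * (-1) * (1 - x) := by
      simp; ring
    rw [h1, h2, map_mul, map_mul, map_mul]
    linear_combination (-(quadraticChar F (-1) * quadraticChar F x * quadraticChar F (1 - x))) *
      quadraticChar_mul_self hd
  rw [e, ← Finset.mul_sum, key]
  linear_combination -quadraticChar_mul_self (F := F) (neg_ne_zero.2 one_ne_zero)

theorem sum_quadraticChar_mul_sub (hF : ringChar F ≠ 2) {k : F} (hk : k ≠ 0) :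
    ∑ t : F, quadraticChar F t * quadraticChar F (k - t) = -quadraticChar F (-1) := by
  have h := sum_quadraticChar_sub_mul_sub hF hk.symm
  have e : ∀ t : F, quadraticChar F (0 - t) * quadraticChar F (k - t)
      = quadraticChar F (-1) * (quadraticChar F t * quadraticChar F (k - t)) := fun t => by
    rw [zero_sub, ← neg_one_mul t, map_mul, mul_assoc]
  rw [Finset.sum_congr rfl fun t _ => e t, ← Finset.mul_sum] at h
  linear_combination (quadraticChar F (-1)) * h -
    (∑ t : F, quadraticChar F t * quadraticChar F (k - t)) *
      quadraticChar_mul_self (F := F) (neg_ne_zero.2 one_ne_zero)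

/-- A nontrivial bound for the character sum of a cubic in Legendre form, obtained from the
substitution `t ↦ 1 - t`. -/
theorem two_mul_abs_sum_quadraticChar_cubic_le (hF : ringChar F ≠ 2) {l : F} (hl : 2 * l ≠ 1) :
    2 * |∑ t : F, quadraticChar F t * quadraticChar F (1 - t) * quadraticChar F (l - t)|
      ≤ Fintype.card F + 1 := by
  set f : F → ℤ := fun t => quadraticChar F t * quadraticChar F (1 - t) * quadraticChar F (l - t)
    with hf
  have hsum : ∑ t, f (1 - t) = ∑ t, f t := Fintype.sum_equiv (Equiv.subLeft 1) _ _ fun t => rfl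
  -- The factor χ(t)χ(1 - t) is common to both terms, leaving |χ(l - t) + χ(l - 1 + t)|. For two
  -- values x, y in {0, 1, -1} one has |x + y| ≤ 1 + xy, unless both vanish, when the bound 1 is
  -- still true.
  have hpt : ∀ t, |f t + f (1 - t)| ≤
      1 + quadraticChar F (-1) * (quadraticChar F (l - t) * quadraticChar F ((1 - l) - t)) := by
    intro t
    have e1 : quadraticChar F (-1) * (quadraticChar F (l - t) * quadraticChar F ((1 - l) - t))
        = quadraticChar F (l - t) * quadraticChar F (l - (1 - t)) := by
      rw [mul_left_comm, ← map_mul]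
      congr 2; ring
    rw [e1]
    simp only [hf, sub_sub_cancel]
    rcases quadraticChar_cases t with h1 | h1 | h1 <;>
    rcases quadraticChar_cases (1 - t) with h2 | h2 | h2 <;>
    rcases quadraticChar_cases (l - t) with h3 | h3 | h3 <;>
    rcases quadraticChar_cases (l - (1 - t)) with h4 | h4 | h4 <;>
    simp only [h1, h2, h3, h4] <;> decide
  have hne : l ≠ 1 - l := fun h => hl (by linear_combination h)
  have h2 : 2 * |∑ t, f t| = |∑ t, (f t + f (1 - t))| := by
    rw [Finset.sum_add_distrib, hsum, ← two_mul, abs_mul]; simp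
  rw [h2]
  refine (Finset.abs_sum_le_sum_abs _ _).trans ((Finset.sum_le_sum fun t _ => hpt t).trans ?_)
  rw [Finset.sum_add_distrib, ← Finset.mul_sum, sum_quadraticChar_sub_mul_sub hF hne]
  simp only [Finset.sum_const, Finset.card_univ, nsmul_eq_mul, mul_one]
  rcases quadraticChar_cases (-1 : F) with h | h | h <;> rw [h] <;> linarith

/-- The product (1 + aχ(t))(1 + bχ(k - t)) is 4 on the set counted, at most 2 at t = 0 and t = k,
and 0 elsewhere. Its sum over F is q plus or minus 1. -/
theorem four_mul_card_quadraticChar_pair (hF : ringChar F ≠ 2) {k : F} (hk : k ≠ 0) {a b : ℤ}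
    (ha : a = 1 ∨ a = -1) (hb : b = 1 ∨ b = -1) :
    Fintype.card F ≤ 4 * (Finset.univ.filter fun t : F =>
      quadraticChar F t = a ∧ quadraticChar F (k - t) = b).card + 5 := by
  set S := Finset.univ.filter fun t : F => quadraticChar F t = a ∧ quadraticChar F (k - t) = b
  have hpt : ∀ t : F, (1 + a * quadraticChar F t) * (1 + b * quadraticChar F (k - t)) ≤
      4 * (if t ∈ S then 1 else 0) + 2 * (if t = 0 then 1 else 0)
        + 2 * (if t = k then 1 else 0) := by
    intro t
    have hS : t ∈ S ↔ quadraticChar F t = a ∧ quadraticChar F (k - t) = b := by simp [S]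
    have h0 : t = 0 ↔ quadraticChar F t = 0 := quadraticChar_eq_zero_iff.symm
    have h1 : t = k ↔ quadraticChar F (k - t) = 0 := by
      rw [quadraticChar_eq_zero_iff, sub_eq_zero, eq_comm]
    simp only [hS, h0, h1]
    rcases ha with rfl | rfl <;> rcases hb with rfl | rfl <;>
    rcases quadraticChar_cases t with h1 | h1 | h1 <;>
    rcases quadraticChar_cases (k - t) with h2 | h2 | h2 <;>
    simp only [h1, h2] <;> decide
  have hs := Finset.sum_le_sum fun t (_ : t ∈ Finset.univ) => hpt t
  have e : ∀ t : F, (1 + a * quadraticChar F t) * (1 + b * quadraticChar F (k - t)) =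
      1 + a * quadraticChar F t + b * quadraticChar F (k - t)
        + a * b * (quadraticChar F t * quadraticChar F (k - t)) := fun t => by ring
  rw [Finset.sum_congr rfl fun t _ => e t] at hs
  simp only [Finset.sum_add_distrib, ← Finset.mul_sum, sum_quadraticChar_sub hF,
    quadraticChar_sum_zero hF, sum_quadraticChar_mul_sub hF hk, Finset.sum_const, Finset.card_univ,
    nsmul_eq_mul, mul_one, Finset.sum_ite_eq', Finset.mem_univ, if_true, Finset.sum_ite_mem,
    Finset.univ_inter, mul_zero, add_zero] at hs
  zify
  rcases ha with rfl | rfl <;> rcases hb with rfl | rfl <;>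
  rcases quadraticChar_cases (-1 : F) with h | h | h <;> rw [h] at hs <;> linarith

/-- The same indicator method with three factors: the value is 8 on the set and at most 4 at each of
0, 1, l. The pair sums contribute at least -3 and the cubic sum at least -(q + 1)/2, so half of q
survives. -/
theorem sixteen_mul_card_quadraticChar_triple (hF : ringChar F ≠ 2) {l : F} (h0 : l ≠ 0)
    (h1 : l ≠ 1) (hl : 2 * l ≠ 1) {b : ℤ} (hb : b = 1 ∨ b = -1) :
    Fintype.card F ≤ 16 * (Finset.univ.filter fun t : F => quadraticChar F t = 1 ∧
      quadraticChar F (1 - t) = -1 ∧ quadraticChar F (l - t) = b).card + 31 := by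
  set S := Finset.univ.filter fun t : F => quadraticChar F t = 1 ∧
      quadraticChar F (1 - t) = -1 ∧ quadraticChar F (l - t) = b
  have hpt : ∀ t : F, (1 + quadraticChar F t) * (1 - quadraticChar F (1 - t)) *
      (1 + b * quadraticChar F (l - t)) ≤
      8 * (if t ∈ S then 1 else 0) + 4 * (if t = 0 then 1 else 0)
        + 4 * (if t = 1 then 1 else 0) + 4 * (if t = l then 1 else 0) := by
    intro t
    have hS : t ∈ S ↔ quadraticChar F t = 1 ∧
      quadraticChar F (1 - t) = -1 ∧ quadraticChar F (l - t) = b := by simp [S]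
    have h0 : t = 0 ↔ quadraticChar F t = 0 := quadraticChar_eq_zero_iff.symm
    have h1 : ∀ k, t = k ↔ quadraticChar F (k - t) = 0 := fun k => by
      rw [quadraticChar_eq_zero_iff, sub_eq_zero, eq_comm]
    simp only [hS, h0, h1 1, h1 l]
    rcases hb with rfl | rfl <;>
    rcases quadraticChar_cases t with h1 | h1 | h1 <;>
    rcases quadraticChar_cases (1 - t) with h2 | h2 | h2 <;>
    rcases quadraticChar_cases (l - t) with h3 | h3 | h3 <;>
    simp only [h1, h2, h3] <;> decide
  have hs := Finset.sum_le_sum fun t (_ : t ∈ Finset.univ) => hpt t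
  have e : ∀ t : F, (1 + quadraticChar F t) * (1 - quadraticChar F (1 - t)) *
      (1 + b * quadraticChar F (l - t)) =
      1 + quadraticChar F t + (-1) * quadraticChar F (1 - t) + b * quadraticChar F (l - t)
        + (-1) * (quadraticChar F t * quadraticChar F (1 - t))
        + b * (quadraticChar F t * quadraticChar F (l - t))
        + (-b) * (quadraticChar F (1 - t) * quadraticChar F (l - t))
        + (-b) * (quadraticChar F t * quadraticChar F (1 - t) * quadraticChar F (l - t)) :=
    fun t => by ring
  have hS := two_mul_abs_sum_quadraticChar_cubic_le hF hl
  rw [Finset.sum_congr rfl fun t _ => e t] at hs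
  simp only [Finset.sum_add_distrib, ← Finset.mul_sum, sum_quadraticChar_sub hF,
    quadraticChar_sum_zero hF, sum_quadraticChar_mul_sub hF h0,
    sum_quadraticChar_mul_sub hF one_ne_zero, sum_quadraticChar_sub_mul_sub hF h1.symm,
    Finset.sum_const, Finset.card_univ,
    nsmul_eq_mul, mul_one, Finset.sum_ite_eq', Finset.mem_univ, if_true, Finset.sum_ite_mem,
    Finset.univ_inter, mul_zero, add_zero] at hs
  have hS1 := le_abs_self
    (∑ t : F, quadraticChar F t * quadraticChar F (1 - t) * quadraticChar F (l - t))
  have hS2 := neg_le_abs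
    (∑ t : F, quadraticChar F t * quadraticChar F (1 - t) * quadraticChar F (l - t))
  zify
  rcases hb with rfl | rfl <;>
  rcases quadraticChar_cases (-1 : F) with h | h | h <;> rw [h] at hs <;> linarith

end CharacterSums

open Matrix

/-! ### Half-turns, their axes, and the commuting involution. -/

section HalfTurns

variable {F : Type*} [Field F]

/-- `g` is the half-turn about the axis spanned by the nonisotropic vector `u`. -/
def IsHalfTurn (g : SO3 F) (u : Fin 3 → F) : Prop :=
  u ⬝ᵥ u ≠ 0 ∧ (g : Matrix (Fin 3) (Fin 3) F) = (2 / (u ⬝ᵥ u)) • vecMulVec u u - 1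

theorem SO3.mul_transpose (g : SO3 F) :
    (g : Matrix (Fin 3) (Fin 3) F) * (g : Matrix (Fin 3) (Fin 3) F)ᵀ = 1 :=
  (mem_orthogonalGroup_iff (Fin 3) F).1 g.2.1

theorem SO3.transpose_mul (g : SO3 F) :
    (g : Matrix (Fin 3) (Fin 3) F)ᵀ * (g : Matrix (Fin 3) (Fin 3) F) = 1 :=
  (mem_orthogonalGroup_iff' (Fin 3) F).1 g.2.1

theorem SO3.det_eq_one (g : SO3 F) : (g : Matrix (Fin 3) (Fin 3) F).det = 1 := g.2.2

theorem SO3.coe_inv (g : SO3 F) :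
    ((g⁻¹ : SO3 F) : Matrix (Fin 3) (Fin 3) F) = (g : Matrix (Fin 3) (Fin 3) F)ᵀ := rfl

theorem SO3.coe_mul (g h : SO3 F) : ((g * h : SO3 F) : Matrix (Fin 3) (Fin 3) F) =
    (g : Matrix (Fin 3) (Fin 3) F) * (h : Matrix (Fin 3) (Fin 3) F) := rfl

theorem SO3.coe_one : ((1 : SO3 F) : Matrix (Fin 3) (Fin 3) F) = 1 := rfl

theorem SO3.adjugate_eq (g : SO3 F) : adjugate (g : Matrix (Fin 3) (Fin 3) F) =
    (g : Matrix (Fin 3) (Fin 3) F)ᵀ := by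
  have h := Matrix.mul_adjugate (g : Matrix (Fin 3) (Fin 3) F)
  rw [SO3.det_eq_one, one_smul] at h
  have h2 := congrArg (fun A => (g : Matrix (Fin 3) (Fin 3) F)ᵀ * A) h
  simpa [← Matrix.mul_assoc, SO3.transpose_mul] using h2

theorem exists_SO3 {A : Matrix (Fin 3) (Fin 3) F} (h : A * Aᵀ = 1) (hd : A.det = 1) :
    ∃ g : SO3 F, (g : Matrix (Fin 3) (Fin 3) F) = A :=
  ⟨⟨A, mem_specialOrthogonalGroup_iff.2 ⟨(mem_orthogonalGroup_iff (Fin 3) F).2 h, hd⟩⟩, rfl⟩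

theorem dotProduct_cross_self (u v : Fin 3 → F) :
    (u ⨯₃ v) ⬝ᵥ (u ⨯₃ v) = (u ⬝ᵥ u) * (v ⬝ᵥ v) - (u ⬝ᵥ v) ^ 2 := by
  rw [cross_dot_cross, dotProduct_comm v u]; ring

theorem cross_eq_zero_iff {u v : Fin 3 → F} :
    u ⨯₃ v = 0 ↔ ∀ i j, u i * v j = u j * v i := by
  rw [cross_apply]
  constructor
  · intro h
    have h0 := congrFun h 0
    have h1 := congrFun h 1
    have h2 := congrFun h 2
    simp at h0 h1 h2
    intro i j
    fin_cases i <;> fin_cases j <;> simp <;>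
      first
      | ring1
      | linear_combination h0
      | linear_combination -h0
      | linear_combination h1
      | linear_combination -h1
      | linear_combination h2
      | linear_combination -h2
  · intro h
    ext i
    fin_cases i <;> simp [h 1 2, h 2 0, h 0 1]

theorem eq_smul_of_cross_eq_zero {u v : Fin 3 → F} (hu : u ⬝ᵥ u ≠ 0) (h : u ⨯₃ v = 0) :
    v = (u ⬝ᵥ v / (u ⬝ᵥ u)) • u := by
  rw [cross_eq_zero_iff] at h
  have key : ∀ j, (u ⬝ᵥ u) * v j = (u ⬝ᵥ v) * u j := by
    intro j
    simp only [dotProduct, Finset.sum_mul]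
    refine Finset.sum_congr rfl fun i _ => ?_
    linear_combination u i * h i j
  ext j
  simp only [Pi.smul_apply, smul_eq_mul]
  rw [div_mul_eq_mul_div, eq_div_iff hu]
  linear_combination key j

theorem cross_eq_zero_of_smul (u : Fin 3 → F) (k : F) : u ⨯₃ (k • u) = 0 := by
  rw [map_smul, cross_self, smul_zero]

theorem exists_isHalfTurn {u : Fin 3 → F} (hu : u ⬝ᵥ u ≠ 0) : ∃ g : SO3 F, IsHalfTurn g u := by
  have ha : 2 / (u ⬝ᵥ u) * (u ⬝ᵥ u) = 2 := div_mul_cancel₀ _ hu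
  obtain ⟨g, hg⟩ : ∃ g : SO3 F,
      (g : Matrix (Fin 3) (Fin 3) F) = (2 / (u ⬝ᵥ u)) • vecMulVec u u - 1 := by
    generalize 2 / (u ⬝ᵥ u) = a at ha
    apply exists_SO3
    · have ht : (a • vecMulVec u u - 1)ᵀ = a • vecMulVec u u - 1 := by
        rw [transpose_sub, transpose_smul, transpose_one, transpose_vecMulVec]
      rw [ht, Matrix.sub_mul, Matrix.mul_sub, Matrix.mul_sub, Matrix.smul_mul, Matrix.mul_smul,
        vecMulVec_mul_vecMulVec, vecMulVec_smul, smul_smul, smul_smul,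
        mul_assoc, ha, Matrix.mul_one, Matrix.one_mul, Matrix.one_mul, mul_two, add_smul]
      abel
    · rw [det_fin_three]
      simp only [dotProduct, Fin.sum_univ_three] at ha
      simp [vecMulVec_apply]
      linear_combination ha
  exact ⟨g, hu, hg⟩

variable {g h : SO3 F} {u v : Fin 3 → F}

theorem IsHalfTurn.coe_mul (hg : IsHalfTurn g u) (hh : IsHalfTurn h v) :
    ((g * h : SO3 F) : Matrix (Fin 3) (Fin 3) F) =
      (2 / (u ⬝ᵥ u) * (2 / (v ⬝ᵥ v)) * (u ⬝ᵥ v)) • vecMulVec u v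
        - (2 / (u ⬝ᵥ u)) • vecMulVec u u - (2 / (v ⬝ᵥ v)) • vecMulVec v v + 1 := by
  rw [SO3.coe_mul, hg.2, hh.2]
  rw [Matrix.sub_mul, Matrix.mul_sub, Matrix.mul_sub, Matrix.smul_mul, Matrix.mul_smul,
    vecMulVec_mul_vecMulVec, vecMulVec_smul, smul_smul, smul_smul,
    Matrix.mul_one, Matrix.one_mul, Matrix.one_mul]
  abel

theorem IsHalfTurn.trace_mul (hg : IsHalfTurn g u) (hh : IsHalfTurn h v) :
    ((g * h : SO3 F) : Matrix (Fin 3) (Fin 3) F).trace =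
      4 * (u ⬝ᵥ v) ^ 2 / ((u ⬝ᵥ u) * (v ⬝ᵥ v)) - 1 := by
  have h1 := hg.1
  have h2 := hh.1
  rw [hg.coe_mul hh]
  simp only [trace_add, trace_sub, trace_smul, trace_vecMulVec, trace_one, Fintype.card_fin,
    smul_eq_mul]
  field_simp
  push_cast
  ring

theorem IsHalfTurn.mul_self (hg : IsHalfTurn g u) : g * g = 1 := by
  apply Subtype.ext
  have h1 := hg.1
  rw [hg.coe_mul hg, SO3.coe_one, mul_assoc (2 / (u ⬝ᵥ u)), div_mul_cancel₀ _ h1, mul_two,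
    add_smul]
  abel

theorem IsHalfTurn.trace (hg : IsHalfTurn g u) :
    (g : Matrix (Fin 3) (Fin 3) F).trace = -1 := by
  have h1 := hg.1
  rw [hg.2]
  simp only [trace_sub, trace_smul, trace_vecMulVec, trace_one, Fintype.card_fin,
    smul_eq_mul]
  field_simp
  push_cast
  ring

theorem IsHalfTurn.orderOf_eq_two (h2 : (2 : F) ≠ 0) (hg : IsHalfTurn g u) : orderOf g = 2 := by
  refine orderOf_eq_prime (by rw [sq, hg.mul_self]) ?_
  rintro rfl
  have := hg.trace
  rw [SO3.coe_one, trace_one, Fintype.card_fin] at this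
  push_cast at this
  have h4 : (2 : F) * 2 = 0 := by linear_combination this
  simp [h2] at h4

theorem IsHalfTurn.mulVec (hg : IsHalfTurn g u) (x : Fin 3 → F) :
    (g : Matrix (Fin 3) (Fin 3) F) *ᵥ x = (2 / (u ⬝ᵥ u) * (u ⬝ᵥ x)) • u - x := by
  rw [hg.2, sub_mulVec, one_mulVec, smul_mulVec, vecMulVec_mulVec, mul_smul]
  congr 1
  ext i
  simp

theorem IsHalfTurn.eq_iff (h2 : (2 : F) ≠ 0) (hg : IsHalfTurn g u) (hh : IsHalfTurn h v) :
    g = h ↔ u ⨯₃ v = 0 := by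
  have h1 := hg.1
  have h1' := hh.1
  constructor
  · rintro rfl
    have e1 := hg.mulVec v
    have e2 := hh.mulVec v
    rw [e2, div_mul_cancel₀ _ h1', two_smul, add_sub_cancel_right] at e1
    have e3 : v = ((2 / (u ⬝ᵥ u) * (u ⬝ᵥ v)) / 2) • u := by
      ext i
      have := congrFun e1 i
      simp only [Pi.sub_apply, Pi.smul_apply, smul_eq_mul] at this ⊢
      field_simp at this ⊢
      apply mul_left_cancel₀ h2
      linear_combination this
    rw [e3, cross_eq_zero_of_smul]
  · intro hc
    have e := eq_smul_of_cross_eq_zero h1 hc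
    apply Subtype.ext
    rw [hg.2, hh.2]
    generalize u ⬝ᵥ v / (u ⬝ᵥ u) = k at e
    subst e
    have hk : k ≠ 0 := by rintro rfl; simp at h1'
    rw [vecMulVec_smul, smul_vecMulVec, smul_smul, smul_smul, dotProduct_smul, smul_dotProduct]
    congr 2
    simp only [smul_eq_mul]
    field_simp

/-- The axis determines u up to a scalar, so the class of u ⬝ᵥ u modulo squares is an invariant of
the half-turn. This is the invariant that distinguishes conjugacy classes in
`IsHalfTurn.odd_orderOf_mul`. -/
theorem IsHalfTurn.isSquare_mul (h2 : (2 : F) ≠ 0) (hg : IsHalfTurn g u) (hg' : IsHalfTurn g v) :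
    IsSquare ((u ⬝ᵥ u) * (v ⬝ᵥ v)) := by
  have e := eq_smul_of_cross_eq_zero hg.1 ((hg.eq_iff h2 hg').1 rfl)
  rw [e]
  refine ⟨(u ⬝ᵥ u) * (u ⬝ᵥ v / (u ⬝ᵥ u)), ?_⟩
  simp only [dotProduct_smul, smul_dotProduct, smul_eq_mul]
  ring

theorem IsHalfTurn.commute_iff (h2 : (2 : F) ≠ 0) (hg : IsHalfTurn g u) (hh : IsHalfTurn h v) :
    Commute g h ↔ u ⬝ᵥ v = 0 ∨ u ⨯₃ v = 0 := by
  have h1 := hg.1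
  have h1' := hh.1
  constructor
  · intro hc
    have e := congrArg (fun x : SO3 F => (x : Matrix (Fin 3) (Fin 3) F)) hc.eq
    simp only [hg.coe_mul hh, hh.coe_mul hg] at e
    by_cases hd : u ⬝ᵥ v = 0
    · exact Or.inl hd
    · right
      rw [cross_eq_zero_iff]
      intro i j
      have := congrFun (congrFun e i) j
      simp only [Matrix.add_apply, Matrix.sub_apply, Matrix.smul_apply, vecMulVec_apply,
        smul_eq_mul, dotProduct_comm v u] at this
      have h3 : 2 / (u ⬝ᵥ u) * (2 / (v ⬝ᵥ v)) * (u ⬝ᵥ v) ≠ 0 := by positivity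
      apply mul_left_cancel₀ h3
      linear_combination this
  · rintro (hd | hd)
    · apply Subtype.ext
      rw [hg.coe_mul hh, hh.coe_mul hg, dotProduct_comm v u, hd, mul_zero, zero_smul, mul_zero,
        zero_smul]
      abel
    · rw [(hg.eq_iff h2 hh).2 hd]

theorem SO3.mulVec_dotProduct (g : SO3 F) (x y : Fin 3 → F) :
    ((g : Matrix (Fin 3) (Fin 3) F) *ᵥ x) ⬝ᵥ ((g : Matrix (Fin 3) (Fin 3) F) *ᵥ y) = x ⬝ᵥ y := by
  rw [dotProduct_mulVec, ← mulVec_transpose, mulVec_mulVec, SO3.transpose_mul, one_mulVec]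

theorem IsHalfTurn.conj (hg : IsHalfTurn g u) (k : SO3 F) :
    IsHalfTurn (k * g * k⁻¹) ((k : Matrix (Fin 3) (Fin 3) F) *ᵥ u) := by
  refine ⟨by rw [SO3.mulVec_dotProduct]; exact hg.1, ?_⟩
  rw [SO3.coe_mul, SO3.coe_mul, SO3.coe_inv, hg.2, SO3.mulVec_dotProduct, Matrix.mul_sub,
    Matrix.sub_mul, Matrix.mul_one, SO3.mul_transpose, Matrix.mul_smul, Matrix.smul_mul,
    mul_vecMulVec, vecMulVec_mul, vecMul_transpose]

/-- An involution A satisfies A = Aᵀ = A⁻¹ = adj A. Comparing A² = 1 with adj A = A shows that A is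
scalar, hence 1, unless its trace is -1. With trace -1, A + 1 has rank one and a nonzero column of
it spans the axis. -/
theorem exists_isHalfTurn_of_orderOf_eq_two (h2 : (2 : F) ≠ 0) (hg : orderOf g = 2) :
    ∃ u, IsHalfTurn g u := by
  have hgg : g * g = 1 := by rw [← sq, ← hg, pow_orderOf_eq_one]
  have hne : g ≠ 1 := by rintro rfl; simp at hg
  have hinv : g⁻¹ = g := inv_eq_of_mul_eq_one_right hgg
  have hsymm : (g : Matrix (Fin 3) (Fin 3) F)ᵀ = g := by rw [← SO3.coe_inv, hinv]
  have hsq : (g : Matrix (Fin 3) (Fin 3) F) * g = 1 := by rw [← SO3.coe_mul, hgg, SO3.coe_one]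
  have hadj := SO3.adjugate_eq g
  have hdet := SO3.det_eq_one g
  have hne' : (g : Matrix (Fin 3) (Fin 3) F) ≠ 1 := fun h => hne (Subtype.ext h)
  suffices h : ∃ u : Fin 3 → F, u ⬝ᵥ u ≠ 0 ∧
      (g : Matrix (Fin 3) (Fin 3) F) = (2 / (u ⬝ᵥ u)) • vecMulVec u u - 1 from h
  rw [hsymm] at hadj
  generalize (g : Matrix (Fin 3) (Fin 3) F) = A at *
  have s01 : A 1 0 = A 0 1 := congrFun (congrFun hsymm 0) 1
  have s02 : A 2 0 = A 0 2 := congrFun (congrFun hsymm 0) 2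
  have s12 : A 2 1 = A 1 2 := congrFun (congrFun hsymm 1) 2
  have q : ∀ i j, A i 0 * A 0 j + A i 1 * A 1 j + A i 2 * A 2 j = (1 : Matrix _ _ F) i j := by
    intro i j
    rw [← hsq, Matrix.mul_apply, Fin.sum_univ_three]
  rw [adjugate_fin_three] at hadj
  have a00 := congrFun (congrFun hadj 0) 0
  have a01 := congrFun (congrFun hadj 0) 1
  have a02 := congrFun (congrFun hadj 0) 2
  have a11 := congrFun (congrFun hadj 1) 1
  have a12 := congrFun (congrFun hadj 1) 2
  have a22 := congrFun (congrFun hadj 2) 2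
  simp only [s01, s02, s12, of_apply, cons_val', cons_val_zero, cons_val_one, cons_val]
    at a00 a01 a02 a11 a12 a22
  have q00 := q 0 0
  have q01 := q 0 1
  have q02 := q 0 2
  have q11 := q 1 1
  have q12 := q 1 2
  have q22 := q 2 2
  simp only [s01, s02, s12, one_apply, Fin.isValue, if_true, zero_ne_one, Fin.reduceEq, if_false]
    at q00 q01 q02 q11 q12 q22
  rw [det_fin_three] at hdet
  simp only [s01, s02, s12] at hdet
  have ht : A 0 0 + A 1 1 + A 2 2 = -1 := by
    by_contra ht
    have ht' : 1 + (A 0 0 + A 1 1 + A 2 2) ≠ 0 := fun h => ht (by linear_combination h)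
    have o01 : A 0 1 = 0 := by
      apply (mul_eq_zero.1 (?_ : (1 + (A 0 0 + A 1 1 + A 2 2)) * A 0 1 = 0)).resolve_left ht'
      linear_combination q01 - a01
    have o02 : A 0 2 = 0 := by
      apply (mul_eq_zero.1 (?_ : (1 + (A 0 0 + A 1 1 + A 2 2)) * A 0 2 = 0)).resolve_left ht'
      linear_combination q02 - a02
    have o12 : A 1 2 = 0 := by
      apply (mul_eq_zero.1 (?_ : (1 + (A 0 0 + A 1 1 + A 2 2)) * A 1 2 = 0)).resolve_left ht'
      linear_combination q12 - a12
    have d01 : A 0 0 = A 1 1 := by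
      apply mul_left_cancel₀ ht'
      linear_combination q00 - q11 - a00 + a11
    have d02 : A 0 0 = A 2 2 := by
      apply mul_left_cancel₀ ht'
      linear_combination q00 - q22 - a00 + a22
    rw [← d01, ← d02, o12] at a00
    rw [o01, o02] at q00
    have d1 : A 0 0 = 1 := by linear_combination q00 - a00
    apply hne'
    ext i j
    fin_cases i <;> fin_cases j <;> simp [s01, s02, s12, o01, o02, o12, d1, ← d01, ← d02]
  -- The three numbers add up to the trace plus 3, that is 2. Since (A + 1)² = 2(A + 1), column i of
  -- A + 1 has squared length 2(A i i + 1), so the chosen column is nonisotropic.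
  have hi : ∃ i, A i i + 1 ≠ 0 := by
    by_contra! hcon
    apply h2
    linear_combination hcon 0 + hcon 1 + hcon 2 - ht
  obtain ⟨i, hi⟩ := hi
  have hQ : (fun k => (A + 1) k i) ⬝ᵥ (fun k => (A + 1) k i) = 2 * (A i i + 1) := by
    simp only [dotProduct, Fin.sum_univ_three]
    fin_cases i <;> simp [s01, s02, s12]
    · linear_combination q00
    · linear_combination q11
    · linear_combination q22
  refine ⟨fun k => (A + 1) k i, ?_, ?_⟩
  · rw [hQ]; exact mul_ne_zero h2 hi
  · rw [hQ]
    ext j k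
    have : A j k * (A i i + 1) = (A + 1) j i * (A + 1) k i - (1 : Matrix _ _ F) j k * (A i i + 1) := by
      fin_cases i <;> fin_cases j <;> fin_cases k <;> simp [s01, s02, s12] <;>
      first
      | ring1
      | linear_combination a00 + ht
      | linear_combination a11 + ht
      | linear_combination a22 + ht
      | linear_combination a01
      | linear_combination a02
      | linear_combination a12
      | linear_combination -a00 + ht
      | linear_combination -a11 + ht
      | linear_combination -a22 + ht
      | linear_combination -a01
      | linear_combination -a02
      | linear_combination -a12
    simp only [Matrix.sub_apply, Matrix.smul_apply, vecMulVec_apply, smul_eq_mul]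
    field_simp
    linear_combination this

/-- As adj g = gᵀ, the two middle coefficients of the characteristic polynomial are both given by
the trace; trace 3 makes the polynomial (X - 1)³. -/
theorem isUnipotent_of_trace (hg : (g : Matrix (Fin 3) (Fin 3) F).trace = 3) :
    SO3.IsUnipotent g := by
  have h1 : ∀ A : Matrix (Fin 3) (Fin 3) F,
      A * A * A - A.trace • (A * A) + (adjugate A).trace • A - A.det • 1 = 0 := by
    intro A
    rw [det_fin_three, adjugate_fin_three, trace_fin_three, trace_fin_three]
    ext i j
    fin_cases i <;> fin_cases j <;> simp [Matrix.mul_apply, Fin.sum_univ_three] <;> ring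
  have h2 := h1 g
  rw [SO3.adjugate_eq, trace_transpose, hg, SO3.det_eq_one, one_smul] at h2
  refine ⟨3, ?_⟩
  rw [← h2]
  have e3 : ∀ A : Matrix (Fin 3) (Fin 3) F, (3 : F) • A = A + A + A := fun A => by
    ext; simp; ring
  rw [e3, e3]
  noncomm_ring

/-- By Lagrange's identity, u × v isotropic means (u·v)² = (u·u)(v·v), which is the case tr(gh) = 3.
-/
theorem dotProduct_cross_ne_zero (hg : IsHalfTurn g u) (hh : IsHalfTurn h v)
    (hun : ¬ SO3.IsUnipotent (g * h)) : (u ⨯₃ v) ⬝ᵥ (u ⨯₃ v) ≠ 0 := by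
  intro h0
  apply hun
  apply isUnipotent_of_trace
  have h1 := hg.1
  have h1' := hh.1
  rw [dotProduct_cross_self] at h0
  rw [hg.trace_mul hh]
  field_simp
  linear_combination -4 * h0

theorem isHalfTurn_ne_of_dotProduct_eq_zero (h2 : (2 : F) ≠ 0) (hg : IsHalfTurn g u)
    (hh : IsHalfTurn h v) (h0 : u ⬝ᵥ v = 0) : g ≠ h := by
  intro he
  have hc := (hg.eq_iff h2 hh).1 he
  have := dotProduct_cross_self u v
  rw [hc, h0] at this
  simp [hg.1, hh.1] at this

/-- An axis orthogonal to u and to v is parallel to u × v, by the triple product formula. -/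
theorem isCommutingInvolution_iff (h2 : (2 : F) ≠ 0) (hg : IsHalfTurn g u) (hh : IsHalfTurn h v)
    {j : SO3 F} (hw : IsHalfTurn j (u ⨯₃ v)) (i : SO3 F) : IsCommutingInvolution g h i ↔ i = j := by
  constructor
  · rintro ⟨ho, hig, hih, hcg, hch⟩
    obtain ⟨c, hc⟩ := exists_isHalfTurn_of_orderOf_eq_two h2 ho
    have e1 := ((hc.commute_iff h2 hg).1 hcg).resolve_right fun h => hig ((hc.eq_iff h2 hg).2 h)
    have e2 := ((hc.commute_iff h2 hh).1 hch).resolve_right fun h => hih ((hc.eq_iff h2 hh).2 h)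
    rw [hc.eq_iff h2 hw, cross_cross_eq_smul_sub_smul', e2,
      dotProduct_comm, e1, zero_smul, zero_smul, sub_zero]
  · rintro rfl
    have d1 : (u ⨯₃ v) ⬝ᵥ u = 0 := by rw [dotProduct_comm, dot_self_cross]
    have d2 : (u ⨯₃ v) ⬝ᵥ v = 0 := by rw [dotProduct_comm, dot_cross_self]
    exact ⟨hw.orderOf_eq_two h2, isHalfTurn_ne_of_dotProduct_eq_zero h2 hw hg d1,
      isHalfTurn_ne_of_dotProduct_eq_zero h2 hw hh d2, (hw.commute_iff h2 hg).2 (Or.inl d1),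
      (hw.commute_iff h2 hh).2 (Or.inl d2)⟩

end HalfTurns

/-! ### Recovering the factors of g = j n m inside dihedral groups. -/

section Midpoints

variable {G : Type*} [Group G]

/-- If `a` and `b` are involutions whose product has odd order dividing `2 * M - 1`, this is the
involution of the dihedral group generated by `a` and `b` which conjugates `a` to `b`. -/
def dihedralMidpoint (M : ℕ) (a b : G) : G := a * (a * b) ^ M

/-- The element which the algorithm computes from the involutions `s`, `t` and a random `g`. -/
def candidate (M : ℕ) (s t g : G) : G :=
  g * dihedralMidpoint M s (g⁻¹ * s * g) * dihedralMidpoint M t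
    ((g * dihedralMidpoint M s (g⁻¹ * s * g))⁻¹ * t * (g * dihedralMidpoint M s (g⁻¹ * s * g)))

/-- Since a · mam = (am)², the power M undoes the squaring and leaves a · am = m. -/
theorem dihedralMidpoint_conj {M : ℕ} {a m : G} (ha : a * a = 1) (h : (a * m) ^ (2 * M) = a * m) :
    dihedralMidpoint M a (m * a * m) = m := by
  have e : a * (m * a * m) = (a * m) ^ 2 := by rw [sq]; simp only [mul_assoc]
  rw [dihedralMidpoint, e, ← pow_mul, h, ← mul_assoc, ha, one_mul]

variable {M : ℕ} {s t j n m : G}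

/-- Conjugation by j and then by n fixes `s`, so only m is visible in the conjugate of `s`. -/
theorem inv_conj_mul (hj : j * j = 1) (hn : n * n = 1) (hm : m * m = 1) (hjs : Commute j s)
    (hns : Commute n s) : (j * n * m)⁻¹ * s * (j * n * m) = m * s * m := by
  have hj' : j⁻¹ = j := inv_eq_of_mul_eq_one_right hj
  have hn' : n⁻¹ = n := inv_eq_of_mul_eq_one_right hn
  have hm' : m⁻¹ = m := inv_eq_of_mul_eq_one_right hm
  rw [_root_.mul_inv_rev, _root_.mul_inv_rev, hj', hn', hm']
  calc m * (n * j) * s * (j * n * m) = m * n * (j * s) * j * n * m := by simp only [mul_assoc]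
    _ = m * n * s * (j * j) * n * m := by rw [hjs.eq]; simp only [mul_assoc]
    _ = m * (n * s) * n * m := by rw [hj]; simp only [mul_assoc, mul_one]
    _ = m * s * (n * n) * m := by rw [hns.eq]; simp only [mul_assoc]
    _ = m * s * m := by rw [hn, mul_one]

theorem dihedralMidpoint_inv_conj_mul (hs : s * s = 1) (hj : j * j = 1) (hn : n * n = 1) (hm : m * m = 1)
    (hjs : Commute j s) (hns : Commute n s) (hsm : (s * m) ^ (2 * M) = s * m) :
    dihedralMidpoint M s ((j * n * m)⁻¹ * s * (j * n * m)) = m := by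
  rw [inv_conj_mul hj hn hm hjs hns, dihedralMidpoint_conj hs hsm]

theorem candidate_mul (hs : s * s = 1) (ht : t * t = 1) (hj : j * j = 1) (hn : n * n = 1)
    (hm : m * m = 1) (hjs : Commute j s) (hjt : Commute j t) (hns : Commute n s)
    (hsm : (s * m) ^ (2 * M) = s * m) (htn : (t * n) ^ (2 * M) = t * n) :
    candidate M s t (j * n * m) = j := by
  have h1 := dihedralMidpoint_inv_conj_mul hs hj hn hm hjs hns hsm
  -- Second round, for g m = j n acting on `t`: the middle factor is trivial and n takes the place
  -- of m.
  have h2 := inv_conj_mul (s := t) (n := 1) hj (mul_one 1) hn hjt (Commute.one_left t)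
  rw [mul_one] at h2
  rw [candidate, h1, mul_assoc (j * n), hm, mul_one, h2, dihedralMidpoint_conj ht htn, mul_assoc, hn,
    mul_one]

theorem isCommutingInvolution_mul (hs : orderOf s = 2) (ht : orderOf t = 2) (hst : s ≠ t)
    (h : Commute s t) : IsCommutingInvolution s t (s * t) := by
  have hs2 : s * s = 1 := by rw [← sq, ← hs, pow_orderOf_eq_one]
  have ht2 : t * t = 1 := by rw [← sq, ← ht, pow_orderOf_eq_one]
  have hs1 : s ≠ 1 := by rintro rfl; simp at hs
  have ht1 : t ≠ 1 := by rintro rfl; simp at ht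
  refine ⟨orderOf_eq_prime ?_ ?_, ?_, ?_, ?_, ?_⟩
  · rw [h.mul_pow, sq, sq, hs2, ht2, one_mul]
  · intro h1
    apply hst
    rw [← inv_eq_of_mul_eq_one_right h1, inv_eq_of_mul_eq_one_right hs2]
  · simpa using ht1
  · simpa using hs1
  · exact (Commute.refl s).mul_left h.symm
  · exact h.mul_left (Commute.refl t)

/-- Here (st)² = s · tst is a product of two distinct commuting involutions, so the commuting case
applies to `s` and `tst`. -/
theorem isCommutingInvolution_sq (hs : orderOf s = 2) (ht : orderOf t = 2) (hst : ¬ Commute s t)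
    (h : Commute s (t * s * t)) : IsCommutingInvolution s t ((s * t) * (s * t)) := by
  have hs2 : s * s = 1 := by rw [← sq, ← hs, pow_orderOf_eq_one]
  have ht2 : t * t = 1 := by rw [← sq, ← ht, pow_orderOf_eq_one]
  have ht' : t⁻¹ = t := inv_eq_of_mul_eq_one_right ht2
  have hconj : t * s * t = t * s * t⁻¹ := by rw [ht']
  have ho : orderOf (t * s * t) = 2 := by
    rw [hconj, ← hs]
    exact orderOf_injective (MulAut.conj t).toMonoidHom (MulAut.conj t).injective s
  have hne : s ≠ t * s * t := by
    intro he
    apply hst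
    rw [commute_iff_eq]
    calc s * t = t * s * t * t := by rw [← he]
      _ = t * s := by rw [mul_assoc, ht2, mul_one]
  have key := isCommutingInvolution_mul hs ho hne h
  have e : (s * t) * (s * t) = s * (t * s * t) := by simp only [mul_assoc]
  rw [← e] at key
  refine ⟨key.1, key.2.1, ?_, key.2.2.2.1, ?_⟩
  · intro h1
    have h2 : s * t * s = 1 := by
      have := congrArg (fun x => x * t) h1
      simpa [mul_assoc, ht2] using this
    have h3 : t = 1 := by
      calc t = s * s * t * (s * s) := by rw [hs2, one_mul, mul_one]
        _ = s * (s * t * s) * s := by simp only [mul_assoc]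
        _ = 1 := by rw [h2, mul_one, hs2]
    simp [h3] at ht
  · rw [commute_iff_eq, e]
    calc s * (t * s * t) * t = s * t * s * (t * t) := by simp only [mul_assoc]
      _ = s * (t * s * t) * t := by rw [ht2, mul_one]; simp only [mul_assoc, ht2, mul_one]
      _ = t * s * t * s * t := by rw [h.eq]
      _ = t * (s * (t * s * t)) := by simp only [mul_assoc]

end Midpoints

/-! ### A squared-length criterion for odd order, and the two exceptional angles. -/

section OddOrder

variable {F : Type*} [Field F] {s t m : SO3 F} {u v c : Fin 3 → F}

theorem IsHalfTurn.mul_cross (h2 : (2 : F) ≠ 0) (hs : IsHalfTurn s u) (hm : IsHalfTurn m c)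
    (h0 : u ⬝ᵥ c = 0) : IsHalfTurn (s * m) (u ⨯₃ c) := by
  have hQ : (u ⨯₃ c) ⬝ᵥ (u ⨯₃ c) ≠ 0 := by
    rw [dotProduct_cross_self, h0]
    simp [hs.1, hm.1]
  obtain ⟨j, hj⟩ := exists_isHalfTurn hQ
  have h := isCommutingInvolution_mul (hs.orderOf_eq_two h2) (hm.orderOf_eq_two h2)
    (isHalfTurn_ne_of_dotProduct_eq_zero h2 hs hm h0) ((hs.commute_iff h2 hm).2 (Or.inl h0))
  rw [(isCommutingInvolution_iff h2 hs hm hj _).1 h]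
  exact hj

/-- Conjugation by `ms` raises the exponent k by 2, so the reflections of the dihedral group fall
into the classes of `s` (k even) and `m` (k odd). -/
theorem exists_conj_of_mul_pow {G : Type*} [Group G] {s m : G} (hs : s * s = 1) (hm : m * m = 1)
    (k : ℕ) : ∃ x : G, s * (s * m) ^ k = x * s * x⁻¹ ∨ s * (s * m) ^ k = x * m * x⁻¹ := by
  have hs' : s⁻¹ = s := inv_eq_of_mul_eq_one_right hs
  have hm' : m⁻¹ = m := inv_eq_of_mul_eq_one_right hm
  induction k using Nat.twoStepInduction with
  | zero => exact ⟨1, Or.inl (by simp)⟩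
  | one => exact ⟨1, Or.inr (by simp [← mul_assoc, hs])⟩
  | more k ih _ =>
    obtain ⟨x, hx⟩ := ih
    have e : s * (s * m) ^ (k + 2) = m * s * (s * (s * m) ^ k) * (m * s)⁻¹ := by
      rw [_root_.mul_inv_rev, hs', hm', pow_succ, pow_succ']
      have h1 : m * s * (s * (s * m) ^ k) = s * (s * m * (s * m) ^ k) := by
        simp only [← mul_assoc, hs, one_mul]
        rw [mul_assoc m s s, hs, mul_one]
      rw [h1]
      simp only [mul_assoc]
    refine ⟨m * s * x, ?_⟩
    rw [e]
    rcases hx with hx | hx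
    · left; rw [hx]; simp only [_root_.mul_inv_rev, mul_assoc]
    · right; rw [hx]; simp only [_root_.mul_inv_rev, mul_assoc]

/-- If the order were 2k, then (sm)^k would be an involution commuting with s and m, hence the
half-turn about w = u × c. So s(sm)^k would be the half-turn about u × w, of squared length
(u·u)(w·w). But it is conjugate to s or m, whose axes have the same squared length modulo squares,
which would make w·w a square. -/
theorem IsHalfTurn.odd_orderOf_mul [Finite F] (h2 : (2 : F) ≠ 0) (hs : IsHalfTurn s u)
    (hm : IsHalfTurn m c) (hsq : IsSquare ((u ⬝ᵥ u) * (c ⬝ᵥ c)))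
    (hns : ¬ IsSquare ((u ⨯₃ c) ⬝ᵥ (u ⨯₃ c))) : Odd (orderOf (s * m)) := by
  have hw0 : (u ⨯₃ c) ⬝ᵥ (u ⨯₃ c) ≠ 0 := fun h => hns (by rw [h]; exact IsSquare.zero)
  have hs2 := hs.mul_self
  have hm2 := hm.mul_self
  have hsm : ¬ Commute s m := by
    rw [hs.commute_iff h2 hm]
    rintro (h | h)
    · apply hns
      rw [dotProduct_cross_self, h]
      simpa using hsq
    · apply hw0
      rw [h, dotProduct_zero]
  rw [← Nat.not_even_iff_odd]
  rintro ⟨k, hk⟩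
  have hpos := orderOf_pos (s * m)
  have hk0 : k ≠ 0 := by omega
  have ho : orderOf ((s * m) ^ k) = 2 := by
    rw [orderOf_pow_of_dvd hk0 ⟨2, by omega⟩, hk, ← two_mul, Nat.mul_div_cancel _ (Nat.pos_of_ne_zero hk0)]
  have hi : (s * m) ^ k * (s * m) ^ k = 1 := by rw [← pow_add, ← hk, pow_orderOf_eq_one]
  have hi' : ((s * m) ^ k)⁻¹ = (s * m) ^ k := inv_eq_of_mul_eq_one_right hi
  have hs' : s⁻¹ = s := inv_eq_of_mul_eq_one_right hs2
  have hm' : m⁻¹ = m := inv_eq_of_mul_eq_one_right hm2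
  have hcs : Commute ((s * m) ^ k) s := by
    have h1 : s * (s * m) ^ k * s⁻¹ = ((s * m) ^ k)⁻¹ := by
      rw [← conj_pow, ← inv_pow]
      congr 1
      rw [_root_.mul_inv_rev, hs', hm', ← mul_assoc, hs2, one_mul]
    rw [hi', mul_inv_eq_iff_eq_mul] at h1
    exact h1.symm
  have hcm : Commute ((s * m) ^ k) m := by
    have h1 : Commute ((s * m) ^ k) (s * (s * m)) := hcs.mul_right (Commute.pow_self _ _)
    rwa [← mul_assoc, hs2, one_mul] at h1
  obtain ⟨j, hj⟩ := exists_isHalfTurn hw0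
  have hij : (s * m) ^ k = j := by
    refine (isCommutingInvolution_iff h2 hs hm hj _).1 ⟨ho, ?_, ?_, hcs, hcm⟩
    · intro h; rw [h] at hcm; exact hsm hcm
    · intro h; rw [h] at hcs; exact hsm hcs.symm
  have hsj := hs.mul_cross h2 hj (dot_self_cross u c)
  have hQ : (u ⨯₃ (u ⨯₃ c)) ⬝ᵥ (u ⨯₃ (u ⨯₃ c)) = (u ⬝ᵥ u) * ((u ⨯₃ c) ⬝ᵥ (u ⨯₃ c)) := by
    rw [dotProduct_cross_self u (u ⨯₃ c), dot_self_cross]; ring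
  have hdiv : ∀ a b : F, a ≠ 0 → IsSquare a → IsSquare (a * b) → IsSquare b := by
    intro a b ha h1 h3
    have := h3.div h1
    rwa [mul_div_cancel_left₀ _ ha] at this
  obtain ⟨x, hx⟩ := exists_conj_of_mul_pow hs2 hm2 k
  rw [hij] at hx
  apply hns
  rcases hx with hx | hx
  · rw [hx] at hsj
    have h3 := (hs.conj x).isSquare_mul h2 hsj
    rw [SO3.mulVec_dotProduct, hQ, ← mul_assoc] at h3
    exact hdiv _ _ (mul_ne_zero hs.1 hs.1) ⟨_, rfl⟩ h3
  · rw [hx] at hsj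
    have h3 := (hm.conj x).isSquare_mul h2 hsj
    rw [SO3.mulVec_dotProduct, hQ, ← mul_assoc, mul_comm (c ⬝ᵥ c)] at h3
    exact hdiv _ _ (mul_ne_zero hs.1 hm.1) hsq h3

/-- The second alternative says that the squared cosine is 1/2, in which case the axes of `s` and
`tst` are orthogonal. -/
theorem isCommutingInvolution_candidates (h2 : (2 : F) ≠ 0) (hs : IsHalfTurn s u)
    (ht : IsHalfTurn t v) (hst : s ≠ t)
    (h : u ⬝ᵥ v = 0 ∨ 2 * (u ⬝ᵥ v) ^ 2 = (u ⬝ᵥ u) * (v ⬝ᵥ v)) :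
    IsCommutingInvolution s t (s * t) ∨ IsCommutingInvolution s t ((s * t) * (s * t)) := by
  have hs2 := hs.orderOf_eq_two h2
  have ht2 := ht.orderOf_eq_two h2
  by_cases hc : Commute s t
  · exact Or.inl (isCommutingInvolution_mul hs2 ht2 hst hc)
  · right
    refine isCommutingInvolution_sq hs2 ht2 hc ?_
    have ht' : t⁻¹ = t := inv_eq_of_mul_eq_one_right ht.mul_self
    have hconj := hs.conj t
    rw [ht'] at hconj
    rw [hs.commute_iff h2 hconj]
    left
    rw [hs.commute_iff h2 ht] at hc
    push Not at hc
    have h0 := h.resolve_left hc.1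
    have h1 := hs.1
    have h1' := ht.1
    rw [ht.mulVec, dotProduct_sub, dotProduct_smul, smul_eq_mul, dotProduct_comm v u]
    field_simp
    linear_combination h0

end OddOrder

/-! ### Explicit axes and a lower bound for the number of successful g. -/

section Counting

variable {F : Type*} [Field F] [Fintype F] [DecidableEq F] {s t j : SO3 F} {u v : Fin 3 → F}

theorem isSquare_mul_of_quadraticChar_eq {a b : F} (ha : a ≠ 0)
    (h : quadraticChar F a = quadraticChar F b) : IsSquare (a * b) := by
  rcases eq_or_ne b 0 with rfl | hb
  · rw [mul_zero]; exact IsSquare.zero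
  rw [← quadraticChar_one_iff_isSquare (mul_ne_zero ha hb), map_mul, ← h]
  exact quadraticChar_mul_self ha

theorem not_isSquare_sq_mul {a b : F} (ha : a ≠ 0) (h : quadraticChar F b = -1) :
    ¬ IsSquare (a ^ 2 * b) := by
  rw [← quadraticChar_neg_one_iff_not_isSquare, map_mul, quadraticChar_sq_one' ha, h, one_mul]

/-- Involutions `n` commuting with `s` for which `t * n` has odd order, parametrized by
the squared cosine `T` of the angle between the axes of `t` and `n`. -/
theorem exists_odd_commuting (h2 : (2 : F) ≠ 0) (hs : IsHalfTurn s u) (ht : IsHalfTurn t v)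
    (hw : (u ⨯₃ v) ⬝ᵥ (u ⨯₃ v) ≠ 0) {T : F} (hT : quadraticChar F T = 1)
    (hT1 : quadraticChar F (1 - T) = -1)
    (hTl : quadraticChar F ((u ⨯₃ v) ⬝ᵥ (u ⨯₃ v) / ((u ⬝ᵥ u) * (v ⬝ᵥ v)) - T) =
      quadraticChar F (u ⬝ᵥ u)) :
    ∃ n : SO3 F, n * n = 1 ∧ Commute n s ∧ Odd (orderOf (t * n)) ∧
      ((t * n : SO3 F) : Matrix (Fin 3) (Fin 3) F).trace = 4 * T - 1 := by
  have hu := hs.1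
  have hv := ht.1
  have hT0 : T ≠ 0 := by rintro rfl; simp at hT
  obtain ⟨x, hx⟩ := (quadraticChar_one_iff_isSquare hT0).1 hT
  obtain ⟨r, hr⟩ := isSquare_mul_of_quadraticChar_eq hu hTl.symm
  have hww := dotProduct_cross_self u v
  have huw : u ⬝ᵥ u ⨯₃ v = 0 := dot_self_cross u v
  have hvw : v ⬝ᵥ u ⨯₃ v = 0 := dot_cross_self u v
  set w := u ⨯₃ v with hw_def
  set a := u ⬝ᵥ u with ha
  set b := v ⬝ᵥ v with hb
  set B := u ⬝ᵥ v with hB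
  set l := w ⬝ᵥ w / (a * b) with hl
  have hl0 : l ≠ 0 := div_ne_zero hw (mul_ne_zero hu hv)
  have hlab : l * (a * b) = w ⬝ᵥ w := div_mul_cancel₀ _ (mul_ne_zero hu hv)
  have hvu : v ⬝ᵥ u = B := dotProduct_comm v u
  have hwu : w ⬝ᵥ u = 0 := by rw [dotProduct_comm, huw]
  have hwv : w ⬝ᵥ v = 0 := by rw [dotProduct_comm, hvw]
  -- Solution of c·u = 0, v·c = xb, c·c = b with x² = T, expanded along the component of v
  -- orthogonal to u and along w. The length equation requires r² = a(l - T), which is what the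
  -- condition on χ(l - T) provides. Then v × c has squared length b²(1 - T), a nonsquare.
  let c : Fin 3 → F := (x / l) • v - (x / l * (B / a)) • u + (r / (a * l)) • w
  have hcu : c ⬝ᵥ u = 0 := by
    simp only [c, add_dotProduct, sub_dotProduct, smul_dotProduct, smul_eq_mul, hvu, hwu, ← ha]
    field_simp
    ring
  have hvc : v ⬝ᵥ c = x * b := by
    simp only [c, dotProduct_add, dotProduct_sub, dotProduct_smul, smul_eq_mul, hvu, hvw, ← hb]
    field_simp
    linear_combination (-x) * hlab - x * hww
  have hwc : w ⬝ᵥ c = r * b := by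
    simp only [c, dotProduct_add, dotProduct_sub, dotProduct_smul, smul_eq_mul, hwu, hwv, ← hlab]
    field_simp
    ring
  have hcc : c ⬝ᵥ c = b := by
    have e : c ⬝ᵥ c = x / l * (v ⬝ᵥ c) - x / l * (B / a) * (u ⬝ᵥ c) + r / (a * l) * (w ⬝ᵥ c) := by
      conv_lhs => enter [1]; simp only [c]
      simp only [add_dotProduct, sub_dotProduct, smul_dotProduct, smul_eq_mul]
    rw [e, hvc, hwc, dotProduct_comm u c, hcu]
    field_simp
    linear_combination (-b * a) * hx - b * hr
  obtain ⟨n, hn⟩ := exists_isHalfTurn (u := c) (by rw [hcc]; exact hv)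
  refine ⟨n, hn.mul_self, (hn.commute_iff h2 hs).2 (Or.inl hcu), ?_, ?_⟩
  · refine ht.odd_orderOf_mul h2 hn (by rw [hcc]; exact ⟨b, rfl⟩) ?_
    rw [dotProduct_cross_self, hcc, hvc, ← hb]
    have e : b * b - (x * b) ^ 2 = b ^ 2 * (1 - T) := by rw [hx]; ring
    rw [e]
    exact not_isSquare_sq_mul hv hT1
  · rw [ht.trace_mul hn, hcc, hvc, hx, ← hb]
    field_simp

/-- Involutions `m` for which `s * m` has odd order. -/
theorem exists_odd_involution (h2 : (2 : F) ≠ 0) (hs : IsHalfTurn s u) {w : Fin 3 → F}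
    (hj : IsHalfTurn j w) (huw : u ⬝ᵥ w = 0) {T Y : F} (hT : quadraticChar F T = 1)
    (hT1 : quadraticChar F (1 - T) = -1) (hY : quadraticChar F Y = 1)
    (hY1 : quadraticChar F ((u ⬝ᵥ u) * (1 - T) / (w ⬝ᵥ w) - Y) = quadraticChar F (u ⬝ᵥ u)) :
    ∃ m : SO3 F, m * m = 1 ∧ Odd (orderOf (s * m)) ∧
      ((s * m : SO3 F) : Matrix (Fin 3) (Fin 3) F).trace = 4 * T - 1 ∧
      ((j * m : SO3 F) : Matrix (Fin 3) (Fin 3) F).trace =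
        4 * (w ⬝ᵥ w / (u ⬝ᵥ u)) * Y - 1 := by
  have hu := hs.1
  have hw := hj.1
  have hT0 : T ≠ 0 := by rintro rfl; simp at hT
  have hY0 : Y ≠ 0 := by rintro rfl; simp at hY
  obtain ⟨x, hx⟩ := (quadraticChar_one_iff_isSquare hT0).1 hT
  obtain ⟨y, hy⟩ := (quadraticChar_one_iff_isSquare hY0).1 hY
  obtain ⟨r, hr⟩ := isSquare_mul_of_quadraticChar_eq hu hY1.symm
  have hzz := dotProduct_cross_self u w
  have huz : u ⬝ᵥ u ⨯₃ w = 0 := dot_self_cross u w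
  have hwz : w ⬝ᵥ u ⨯₃ w = 0 := dot_cross_self u w
  rw [huw] at hzz
  set z := u ⨯₃ w with hz_def
  set a := u ⬝ᵥ u with ha
  set b := w ⬝ᵥ w with hb
  have hwu : w ⬝ᵥ u = 0 := by rw [dotProduct_comm, huw]
  -- In the orthogonal basis u, w, u × w the first two coordinates are square roots of T and Y. The
  -- third is forced by c·c = u·u, and the last character condition makes it exist in F.
  let c : Fin 3 → F := x • u + y • w + (r / a) • z
  have hzu : z ⬝ᵥ u = 0 := by rw [dotProduct_comm, huz]
  have hzw : z ⬝ᵥ w = 0 := by rw [dotProduct_comm, hwz]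
  have huc : u ⬝ᵥ c = x * a := by
    simp only [c, dotProduct_add, dotProduct_smul, smul_eq_mul, huw, huz, ← ha]
    ring
  have hwc : w ⬝ᵥ c = y * b := by
    simp only [c, dotProduct_add, dotProduct_smul, smul_eq_mul, hwu, hwz, ← hb]
    ring
  have hzc : z ⬝ᵥ c = r * b := by
    simp only [c, dotProduct_add, dotProduct_smul, smul_eq_mul, hzu, hzw, hzz]
    field_simp
    ring
  have hcc : c ⬝ᵥ c = a := by
    have e : c ⬝ᵥ c = x * (u ⬝ᵥ c) + y * (w ⬝ᵥ c) + r / a * (z ⬝ᵥ c) := by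
      conv_lhs => enter [1]; simp only [c]
      simp only [add_dotProduct, smul_dotProduct, smul_eq_mul]
    rw [e, huc, hwc, hzc]
    field_simp at hr ⊢
    linear_combination (-a ^ 2) * hx - b * a * hy - hr
  obtain ⟨m, hm⟩ := exists_isHalfTurn (u := c) (by rw [hcc]; exact hu)
  refine ⟨m, hm.mul_self, ?_, ?_, ?_⟩
  · refine hs.odd_orderOf_mul h2 hm (by rw [hcc]; exact ⟨a, rfl⟩) ?_
    rw [dotProduct_cross_self, hcc, huc, ← ha]
    have e : a * a - (x * a) ^ 2 = a ^ 2 * (1 - T) := by rw [hx]; ring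
    rw [e]
    exact not_isSquare_sq_mul hu hT1
  · rw [hs.trace_mul hm, hcc, huc, hx, ← ha]
    field_simp
  · rw [hj.trace_mul hm, hcc, hwc, hy, ← hb]
    field_simp

/-- Here l is the squared sine of the angle between u and v; `h0` and `h1` say that it is neither 1
nor 1/2. The parameters T for n and (T, Y) for m are read off from the traces of tn, sm and jm, so
different parameters give different pairs (n, m). -/
theorem card_candidate (hF : ringChar F ≠ 2) (hs : IsHalfTurn s u) (ht : IsHalfTurn t v)
    (hj : IsHalfTurn j (u ⨯₃ v)) (h0 : u ⬝ᵥ v ≠ 0)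
    (h1 : 2 * (u ⬝ᵥ v) ^ 2 ≠ (u ⬝ᵥ u) * (v ⬝ᵥ v)) {M : ℕ}
    (hM : ∀ x : SO3 F, Odd (orderOf x) → x ^ (2 * M) = x) :
    ∃ N A : ℕ, Fintype.card F ≤ 16 * N + 31 ∧ Fintype.card F ≤ 4 * A + 5 ∧
      N * (A * A) ≤ Nat.card {g : SO3 F // candidate M s t g = j} := by
  have h2 : (2 : F) ≠ 0 := Ring.two_ne_zero hF
  have h4 : (4 : F) ≠ 0 := by
    have : (4 : F) = 2 * 2 := by norm_num
    rw [this]; exact mul_ne_zero h2 h2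
  have hu := hs.1
  have hv := ht.1
  have hw := hj.1
  have hww := dotProduct_cross_self u v
  have hpm : ∀ {a : F}, a ≠ 0 → quadraticChar F a = 1 ∨ quadraticChar F a = -1 :=
    fun ha => quadraticChar_dichotomy ha
  set l := (u ⨯₃ v) ⬝ᵥ (u ⨯₃ v) / ((u ⬝ᵥ u) * (v ⬝ᵥ v)) with hl
  have hl0 : l ≠ 0 := div_ne_zero hw (mul_ne_zero hu hv)
  have hlab : l * ((u ⬝ᵥ u) * (v ⬝ᵥ v)) = (u ⨯₃ v) ⬝ᵥ (u ⨯₃ v) :=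
    div_mul_cancel₀ _ (mul_ne_zero hu hv)
  have hl1 : l ≠ 1 := by
    intro h
    rw [h, hww] at hlab
    exact h0 (pow_eq_zero_iff two_ne_zero |>.1 (by linear_combination hlab))
  have hl2 : 2 * l ≠ 1 := by
    intro h
    apply h1
    linear_combination 2 * hww + 2 * hlab - (u ⬝ᵥ u) * (v ⬝ᵥ v) * h
  have huw : u ⬝ᵥ u ⨯₃ v = 0 := dot_self_cross u v
  have hjs : Commute j s := (hj.commute_iff h2 hs).2 (Or.inl (by rw [dotProduct_comm, huw]))
  have hjt : Commute j t :=
    (hj.commute_iff h2 ht).2 (Or.inl (by rw [dotProduct_comm, dot_cross_self]))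
  let S := Finset.univ.filter fun T : F => quadraticChar F T = 1 ∧
      quadraticChar F (1 - T) = -1 ∧ quadraticChar F (l - T) = quadraticChar F (u ⬝ᵥ u)
  let S1 := Finset.univ.filter fun T : F => quadraticChar F T = 1 ∧ quadraticChar F (1 - T) = -1
  let S2 : F → Finset F := fun T => Finset.univ.filter fun Y : F => quadraticChar F Y = 1 ∧
      quadraticChar F ((u ⬝ᵥ u) * (1 - T) / ((u ⨯₃ v) ⬝ᵥ (u ⨯₃ v)) - Y) = quadraticChar F (u ⬝ᵥ u)
  have hS : Fintype.card F ≤ 16 * S.card + 31 :=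
    sixteen_mul_card_quadraticChar_triple hF hl0 hl1 hl2 (hpm hu)
  have hS1 : Fintype.card F ≤ 4 * S1.card + 5 :=
    four_mul_card_quadraticChar_pair hF one_ne_zero (Or.inl rfl) (Or.inr rfl)
  have hS2 : ∀ T ∈ S1, Fintype.card F ≤ 4 * (S2 T).card + 5 := by
    intro T hT
    refine four_mul_card_quadraticChar_pair hF ?_ (Or.inl rfl) (hpm hu)
    have : 1 - T ≠ 0 := by
      intro h
      have := (Finset.mem_filter.1 hT).2.2
      rw [h] at this
      simp at this
    exact div_ne_zero (mul_ne_zero hu this) hw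
  have hn : ∀ T : S, ∃ n : SO3 F, n * n = 1 ∧ Commute n s ∧ Odd (orderOf (t * n)) ∧
      ((t * n : SO3 F) : Matrix (Fin 3) (Fin 3) F).trace = 4 * T - 1 := fun T =>
    exists_odd_commuting h2 hs ht hw (Finset.mem_filter.1 T.2).2.1 (Finset.mem_filter.1 T.2).2.2.1
      (Finset.mem_filter.1 T.2).2.2.2
  have hm : ∀ P : S1.sigma S2, ∃ m : SO3 F, m * m = 1 ∧ Odd (orderOf (s * m)) ∧
      ((s * m : SO3 F) : Matrix (Fin 3) (Fin 3) F).trace = 4 * P.1.1 - 1 ∧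
      ((j * m : SO3 F) : Matrix (Fin 3) (Fin 3) F).trace =
        4 * ((u ⨯₃ v) ⬝ᵥ (u ⨯₃ v) / (u ⬝ᵥ u)) * P.1.2 - 1 := by
    intro P
    obtain ⟨hP1, hP2⟩ := Finset.mem_sigma.1 P.2
    exact exists_odd_involution h2 hs hj huw (Finset.mem_filter.1 hP1).2.1
      (Finset.mem_filter.1 hP1).2.2 (Finset.mem_filter.1 hP2).2.1 (Finset.mem_filter.1 hP2).2.2
  choose n hn1 hn2 hn3 hn4 using hn
  choose m hm1 hm2 hm3 hm4 using hm
  have hcand : ∀ x : S × S1.sigma S2, candidate M s t (j * n x.1 * m x.2) = j := fun x =>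
    candidate_mul hs.mul_self ht.mul_self hj.mul_self (hn1 _) (hm1 _) hjs hjt (hn2 _)
      (hM _ (hm2 _)) (hM _ (hn3 _))
  have hmid : ∀ x : S × S1.sigma S2, dihedralMidpoint M s
      ((j * n x.1 * m x.2)⁻¹ * s * (j * n x.1 * m x.2)) = m x.2 := fun x =>
    dihedralMidpoint_inv_conj_mul hs.mul_self hj.mul_self (hn1 _) (hm1 _) hjs (hn2 _)
      (hM _ (hm2 _))
  -- The second witness is the lower bound that q ≤ 4x + 5 implies for an integer x. It serves both
  -- for `S1` and, uniformly in T, for the fibres `S2 T`.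
  refine ⟨S.card, (Fintype.card F - 2) / 4, hS, by omega, ?_⟩
  have hinj : Function.Injective fun x : S × S1.sigma S2 =>
      (⟨j * n x.1 * m x.2, hcand x⟩ : {g : SO3 F // candidate M s t g = j}) := by
    intro x y hxy
    have e : j * n x.1 * m x.2 = j * n y.1 * m y.2 := congrArg Subtype.val hxy
    -- The group element g determines m as a dihedral midpoint; cancelling j and m then determines
    -- n.
    have em : m x.2 = m y.2 := by rw [← hmid x, ← hmid y, e]
    have en : n x.1 = n y.1 := by
      rw [em] at e
      exact mul_left_cancel (mul_right_cancel e)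
    have e1 : (x.1 : F) = y.1 := by
      have := hn4 x.1
      rw [en, hn4 y.1] at this
      exact mul_left_cancel₀ h4 (by linear_combination -this)
    have e2 : x.2.1.1 = y.2.1.1 := by
      have := hm3 x.2
      rw [em, hm3 y.2] at this
      exact mul_left_cancel₀ h4 (by linear_combination -this)
    have e3 : x.2.1.2 = y.2.1.2 := by
      have := hm4 x.2
      rw [em, hm4 y.2] at this
      exact mul_left_cancel₀ (mul_ne_zero h4 (div_ne_zero hw hu)) (by linear_combination -this)
    refine Prod.ext (Subtype.ext e1) (Subtype.ext (Sigma.ext e2 (heq_of_eq e3)))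
  have hle := Nat.card_le_card_of_injective _ hinj
  refine le_trans ?_ hle
  rw [Nat.card_prod, Nat.card_eq_fintype_card, Nat.card_eq_fintype_card, Fintype.card_coe,
    Fintype.card_coe, Finset.card_sigma]
  refine Nat.mul_le_mul_left _ ?_
  have h5 := Finset.card_nsmul_le_sum S1 (fun T => (S2 T).card) ((Fintype.card F - 2) / 4)
    fun T hT => by have := hS2 T hT; omega
  refine le_trans ?_ h5
  rw [smul_eq_mul]
  exact Nat.mul_le_mul_right _ (by omega)

end Counting

/-! ### The order of SO₃(F) and the density of successful elements. -/

section Density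

variable {F : Type*} [Field F]

theorem SO3.det_add_one (g : SO3 F) : ((g : Matrix (Fin 3) (Fin 3) F) + 1).det =
    2 * (1 + (g : Matrix (Fin 3) (Fin 3) F).trace) := by
  have h : ∀ A : Matrix (Fin 3) (Fin 3) F,
      (A + 1).det = 1 + A.trace + (adjugate A).trace + A.det := by
    intro A
    rw [adjugate_fin_three, det_fin_three, det_fin_three, trace_fin_three, trace_fin_three]
    simp
    ring
  rw [h, SO3.adjugate_eq, trace_transpose, SO3.det_eq_one]
  ring

/-- The four diagonal sign matrices of determinant 1 add up to 0, so the four traces add up to 0 and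
cannot all be -1. -/
theorem SO3.exists_det_add_one_ne_zero (h2 : (2 : F) ≠ 0) :
    ∃ k : Fin 4 → SO3 F, ∀ g : SO3 F, ∃ i,
      ((g * k i : SO3 F) : Matrix (Fin 3) (Fin 3) F).trace ≠ -1 := by
  have hd : ∀ a b : F, a * a = 1 → b * b = 1 → ∃ g : SO3 F,
      (g : Matrix (Fin 3) (Fin 3) F) = diagonal ![a, b, a * b] := by
    intro a b ha hb
    apply exists_SO3
    · rw [diagonal_transpose, diagonal_mul_diagonal, ← diagonal_one]
      congr 1
      ext i
      fin_cases i <;> simp [ha, hb]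
      linear_combination b * b * ha + hb
    · rw [det_diagonal, Fin.prod_univ_three]
      simp
      linear_combination b * b * ha + hb
  obtain ⟨k0, h0⟩ := hd 1 1 (by ring) (by ring)
  obtain ⟨k1, h1⟩ := hd 1 (-1) (by ring) (by ring)
  obtain ⟨k2, h2'⟩ := hd (-1) 1 (by ring) (by ring)
  obtain ⟨k3, h3⟩ := hd (-1) (-1) (by ring) (by ring)
  refine ⟨![k0, k1, k2, k3], fun g => ?_⟩
  by_contra! hcon
  have e0 := hcon 0
  have e1 := hcon 1
  have e2 := hcon 2
  have e3 := hcon 3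
  simp [trace_fin_three, h0, h1, h2', h3] at e0 e1 e2 e3
  have h4 : (2 : F) * 2 = 0 := by linear_combination e0 + e1 + e2 + e3
  simp [h2] at h4

/-- Cayley transform: (A + 1)⁻¹ is 1/2 plus a skew-symmetric matrix, because (A + 1)(A + 1)ᵀ = (A +
1) + (A + 1)ᵀ. -/
theorem SO3.cayley_add_transpose (g : SO3 F)
    (hd : ((g : Matrix (Fin 3) (Fin 3) F) + 1).det ≠ 0) :
    ((g : Matrix (Fin 3) (Fin 3) F) + 1)⁻¹ + (((g : Matrix (Fin 3) (Fin 3) F) + 1)⁻¹)ᵀ = 1 := by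
  have hA := SO3.mul_transpose g
  generalize (g : Matrix (Fin 3) (Fin 3) F) = A at *
  have hu : IsUnit (A + 1).det := hd.isUnit
  have hu' : IsUnit (A + 1)ᵀ.det := by rwa [det_transpose]
  have hT : ((A + 1)⁻¹)ᵀ * (A + 1)ᵀ = 1 := by
    rw [← Matrix.transpose_mul, Matrix.mul_nonsing_inv _ hu, transpose_one]
  have hmul : (A + 1) * (A + 1)ᵀ = (A + 1)ᵀ + (A + 1) := by
    rw [transpose_add, transpose_one, Matrix.mul_add, Matrix.add_mul, hA, Matrix.one_mul,
      Matrix.mul_one]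
    abel
  have e : (A + 1) * ((A + 1)⁻¹ + ((A + 1)⁻¹)ᵀ) * (A + 1)ᵀ = (A + 1) * (A + 1)ᵀ := by
    rw [Matrix.mul_add, Matrix.add_mul, Matrix.mul_nonsing_inv _ hu, Matrix.one_mul,
      Matrix.mul_assoc, hT, Matrix.mul_one, hmul]
  have e1 := congrArg (fun B => (A + 1)⁻¹ * (B * ((A + 1)ᵀ)⁻¹)) e
  rwa [Matrix.mul_nonsing_inv_cancel_right _ _ hu', Matrix.mul_nonsing_inv_cancel_right _ _ hu',
    Matrix.nonsing_inv_mul_cancel_left _ _ hu, Matrix.nonsing_inv_mul _ hu] at e1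

/-- After translation into the domain of the Cayley transform by one of four elements, g is
determined by three coordinates: the entries (0,1), (1,2), (2,0), with r + 1 taken cyclically. -/
theorem SO3.card_le [Finite F] (h2 : (2 : F) ≠ 0) :
    Nat.card (SO3 F) ≤ 4 * Nat.card F ^ 3 := by
  obtain ⟨k, hk⟩ := SO3.exists_det_add_one_ne_zero h2
  choose i hi using hk
  have hdet : ∀ g : SO3 F, (((g * k (i g) : SO3 F) : Matrix (Fin 3) (Fin 3) F) + 1).det ≠ 0 := by
    intro g
    rw [SO3.det_add_one]
    exact mul_ne_zero h2 fun h => hi g (by linear_combination h)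
  let N : SO3 F → Matrix (Fin 3) (Fin 3) F := fun g =>
    (((g * k (i g) : SO3 F) : Matrix (Fin 3) (Fin 3) F) + 1)⁻¹
  have hN : ∀ g, N g + (N g)ᵀ = 1 := fun g => SO3.cayley_add_transpose _ (hdet g)
  have hinj : Function.Injective fun g => (i g, fun r : Fin 3 => N g r (r + 1)) := by
    intro g h hgh
    simp only [Prod.mk.injEq] at hgh
    obtain ⟨h1, h3⟩ := hgh
    have hNN : N g = N h := by
      have a0 := congrFun h3 0
      have a1 := congrFun h3 1
      have a2 := congrFun h3 2
      have hg : ∀ r c, N g r c + N g c r = (1 : Matrix (Fin 3) (Fin 3) F) r c := fun r c =>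
        congrFun (congrFun (hN g) r) c
      have hh : ∀ r c, N h r c + N h c r = (1 : Matrix (Fin 3) (Fin 3) F) r c := fun r c =>
        congrFun (congrFun (hN h) r) c
      simp only [Fin.isValue, zero_add, Fin.reduceAdd] at a0 a1 a2
      have hdiag : ∀ r, N g r r = N h r r := fun r =>
        mul_left_cancel₀ h2 (by linear_combination hg r r - hh r r)
      ext r c
      fin_cases r <;> fin_cases c
      · exact hdiag 0
      · exact a0
      · change N g 0 2 = N h 0 2
        linear_combination hg 0 2 - hh 0 2 - a2
      · change N g 1 0 = N h 1 0
        linear_combination hg 1 0 - hh 1 0 - a0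
      · exact hdiag 1
      · exact a1
      · exact a2
      · change N g 2 1 = N h 2 1
        linear_combination hg 2 1 - hh 2 1 - a1
      · exact hdiag 2
    have hinv := congrArg (fun B => B⁻¹) hNN
    simp only [N] at hinv
    rw [nonsing_inv_nonsing_inv _ (hdet g).isUnit, nonsing_inv_nonsing_inv _ (hdet h).isUnit,
      add_left_inj] at hinv
    have := Subtype.ext hinv
    rw [h1] at this
    exact mul_right_cancel this
  have hle := Nat.card_le_card_of_injective _ hinj
  rwa [Nat.card_prod, Nat.card_fun, Nat.card_fin, Nat.card_fin] at hle

theorem card_SO3_le_mul_card_success [Finite F] (h2 : (2 : F) ≠ 0) {s t : SO3 F}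
    (hs : orderOf s = 2) (ht : orderOf t = 2) (hst : s ≠ t) (hun : ¬ SO3.IsUnipotent (s * t))
    (h1 : ¬ IsCommutingInvolution s t (s * t))
    (h1' : ¬ IsCommutingInvolution s t ((s * t) * (s * t))) {M : ℕ}
    (hM : ∀ x : SO3 F, Odd (orderOf x) → x ^ (2 * M) = x) :
    Nat.card (SO3 F) ≤ 2 ^ 20 * Nat.card {g : SO3 F //
      IsCommutingInvolution s t g ∨ IsCommutingInvolution s t (candidate M s t g)} := by
  classical
  have := Fintype.ofFinite F
  have hF : ringChar F ≠ 2 := fun h => h2 (by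
    have := ringChar.Nat.cast_ringChar (R := F)
    rw [h] at this
    exact_mod_cast this)
  obtain ⟨u, hs'⟩ := exists_isHalfTurn_of_orderOf_eq_two h2 hs
  obtain ⟨v, ht'⟩ := exists_isHalfTurn_of_orderOf_eq_two h2 ht
  have hw := dotProduct_cross_ne_zero hs' ht' hun
  obtain ⟨j, hj⟩ := exists_isHalfTurn hw
  have hiff := isCommutingInvolution_iff h2 hs' ht' hj
  have hcase : ¬ (u ⬝ᵥ v = 0 ∨ 2 * (u ⬝ᵥ v) ^ 2 = (u ⬝ᵥ u) * (v ⬝ᵥ v)) := fun h =>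
    (isCommutingInvolution_candidates h2 hs' ht' hst h).elim h1 h1'
  push Not at hcase
  obtain ⟨N, A, hN, hA, hNA⟩ := card_candidate hF hs' ht' hj hcase.1 hcase.2 hM
  have hG := SO3.card_le (F := F) h2
  rw [Nat.card_eq_fintype_card (α := F)] at hG
  set q := Fintype.card F
  set C := Nat.card {g : SO3 F //
      IsCommutingInvolution s t g ∨ IsCommutingInvolution s t (candidate M s t g)} with hC
  -- The element j itself is accepted as a sample; this settles the small fields.
  have hC1 : 1 ≤ C := by
    have : Nonempty {g : SO3 F //
      IsCommutingInvolution s t g ∨ IsCommutingInvolution s t (candidate M s t g)} :=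
      ⟨⟨j, Or.inl ((hiff j).2 rfl)⟩⟩
    exact Nat.card_pos
  have hC2 : N * (A * A) ≤ C := by
    refine hNA.trans (Nat.card_le_card_of_injective
      (fun x => ⟨x.1, Or.inr ((hiff _).2 x.2)⟩) fun x y hxy => Subtype.ext ?_)
    simpa using hxy
  refine hG.trans ?_
  -- For q ≤ 64 the single success is enough, as 4 · 64³ = 2²⁰. Above that the additive constants
  -- are absorbed into q ≤ 32N and q ≤ 5A.
  rcases le_or_gt q 64 with h | h
  · calc 4 * q ^ 3 ≤ 4 * 64 ^ 3 := by gcongr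
      _ = 2 ^ 20 * 1 := by norm_num
      _ ≤ _ := by gcongr
  · have hN' : q ≤ 32 * N := by omega
    have hA' : q ≤ 5 * A := by omega
    calc 4 * q ^ 3 = 4 * (q * (q * q)) := by ring
      _ ≤ 4 * ((32 * N) * ((5 * A) * (5 * A))) := by gcongr
      _ = 3200 * (N * (A * A)) := by ring
      _ ≤ 2 ^ 20 * C := by gcongr; norm_num

theorem existsUnique_isCommutingInvolution (h2 : (2 : F) ≠ 0) {s t : SO3 F}
    (hs : orderOf s = 2) (ht : orderOf t = 2) (hun : ¬ SO3.IsUnipotent (s * t)) :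
    ∃! j, IsCommutingInvolution s t j := by
  obtain ⟨u, hs'⟩ := exists_isHalfTurn_of_orderOf_eq_two h2 hs
  obtain ⟨v, ht'⟩ := exists_isHalfTurn_of_orderOf_eq_two h2 ht
  obtain ⟨j, hj⟩ := exists_isHalfTurn (dotProduct_cross_ne_zero hs' ht' hun)
  have hiff := isCommutingInvolution_iff h2 hs' ht' hj
  exact ⟨j, (hiff j).2 rfl, fun i hi => (hiff i).1 hi⟩

end Density

/-! ### Bit-size and cost bounds for arithmetic expressions. -/

namespace NumExpr

/-- A constant which bounds the sizes and the costs of evaluating an expression, see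
`NumExpr.size_eval_le` and `NumExpr.cost_le`. -/
def coef : NumExpr → ℕ
  | lit n => n.size + 1
  | get a => 2 * a.coef + 1
  | add a b => a.coef + b.coef + (a.coef + 1) * (b.coef + 1)
  | sub a b => a.coef + b.coef + (a.coef + 1) * (b.coef + 1)
  | mul a b => a.coef + b.coef + (a.coef + 1) * (b.coef + 1)
  | div a b => a.coef + b.coef + (a.coef + 1) * (b.coef + 1)

theorem one_le_coef (e : NumExpr) : 1 ≤ e.coef := by
  cases e <;> simp only [coef] <;> first | omega | exact le_add_left (Nat.mul_pos (by omega) (by omega))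

/-- Every memory read brings the size back to at most that of E, and each operation at most adds the
sizes up to a constant, so nesting affects only the coefficient. -/
theorem size_eval_le {m : ℕ → ℕ} {E : ℕ} (hm : ∀ a, m a ≤ E) (e : NumExpr) :
    (e.eval m).size ≤ e.coef * (E.size + 1) := by
  have hadd : ∀ x y : ℕ, (x + y).size ≤ x.size + y.size + 1 := by
    intro x y
    rw [Nat.size_le]
    have hx := Nat.lt_size_self x
    have hy := Nat.lt_size_self y
    have h1 : 2 ^ x.size ≤ 2 ^ (x.size + y.size) := Nat.pow_le_pow_right two_pos (by omega)
    have h2 : 2 ^ y.size ≤ 2 ^ (x.size + y.size) := Nat.pow_le_pow_right two_pos (by omega)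
    rw [pow_succ]
    omega
  have hmul : ∀ x y : ℕ, (x * y).size ≤ x.size + y.size := by
    intro x y
    rw [Nat.size_le, pow_add]
    exact Nat.mul_lt_mul'' (Nat.lt_size_self x) (Nat.lt_size_self y)
  induction e with
  | lit n => simp only [eval, coef]; nlinarith [Nat.zero_le (n.size * E.size)]
  | get a _ =>
    simp only [eval, coef]
    have := Nat.size_le_size (hm (a.eval m))
    nlinarith [Nat.zero_le (a.coef * E.size)]
  | add a b iha ihb =>
    simp only [eval, coef]
    have := hadd (a.eval m) (b.eval m)
    nlinarith [Nat.zero_le ((a.coef * b.coef + a.coef + b.coef) * (E.size + 1))]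
  | sub a b iha ihb =>
    simp only [eval, coef]
    have := Nat.size_le_size (Nat.sub_le (a.eval m) (b.eval m))
    nlinarith [Nat.zero_le ((a.coef * b.coef + a.coef + b.coef) * (E.size + 1)),
      Nat.zero_le (b.coef * (E.size + 1))]
  | mul a b iha ihb =>
    simp only [eval, coef]
    have := hmul (a.eval m) (b.eval m)
    nlinarith [Nat.zero_le ((a.coef * b.coef + a.coef + b.coef) * (E.size + 1))]
  | div a b iha ihb =>
    simp only [eval, coef]
    have := Nat.size_le_size (Nat.div_le_self (a.eval m) (b.eval m))
    nlinarith [Nat.zero_le ((a.coef * b.coef + a.coef + b.coef) * (E.size + 1)),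
      Nat.zero_le (b.coef * (E.size + 1))]

theorem cost_le {m : ℕ → ℕ} {E : ℕ} (hm : ∀ a, m a ≤ E) (e : NumExpr) :
    e.cost m ≤ e.coef * (E.size + 1) ^ 2 := by
  have key : ∀ a b : NumExpr, ((a.eval m).size + 1) * ((b.eval m).size + 1) ≤
      (a.coef + 1) * (b.coef + 1) * (E.size + 1) ^ 2 := by
    intro a b
    have ha := size_eval_le hm a
    have hb := size_eval_le hm b
    calc ((a.eval m).size + 1) * ((b.eval m).size + 1)
        ≤ ((a.coef + 1) * (E.size + 1)) * ((b.coef + 1) * (E.size + 1)) := by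
          apply Nat.mul_le_mul <;> nlinarith
      _ = _ := by ring
  induction e with
  | lit n => simp only [cost, coef]; nlinarith [Nat.zero_le (n.size * E.size)]
  | get a iha =>
    simp only [cost, coef]
    have h1 := Nat.size_le_size (hm (a.eval m))
    have h2 := size_eval_le hm a
    have h3 : a.coef * (E.size + 1) ≤ a.coef * (E.size + 1) ^ 2 := by gcongr; nlinarith
    nlinarith
  | add a b iha ihb => simp only [cost, coef, add_mul]; linarith [key a b]
  | sub a b iha ihb => simp only [cost, coef, add_mul]; linarith [key a b]
  | mul a b iha ihb => simp only [cost, coef, add_mul]; linarith [key a b]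
  | div a b iha ihb => simp only [cost, coef, add_mul]; linarith [key a b]

end NumExpr

/-- The number of time units (see `BlackBoxGroup.timeUnit`) which suffice for a program,
counting only one pass through each loop. -/
def BBProgram.coef : BBProgram → ℕ
  | .skip => 1
  | .set a e => 2 * a.coef + 2 * e.coef + 1
  | .flip a => 2 * a.coef + 1
  | .sample a => a.coef + 1
  | .mul a b c => a.coef + b.coef + c.coef + 1
  | .inv a b => a.coef + b.coef + 1
  | .same a b c => a.coef + b.coef + c.coef + 1
  | .seq p q => p.coef + q.coef
  | .branch e p q => e.coef + p.coef + q.coef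
  | .loop e p => e.coef + p.coef

/-! ### A Hoare logic with running times. -/

namespace BlackBoxGroup

variable {G : Type*} [Group G] [Finite G] (X : BlackBoxGroup G)

/-- The time within which every instruction can be executed, up to a constant factor, as long as
the numbers in the memory do not exceed `E`. -/
def timeUnit (E : ℕ) : ℕ := (E.size + 1) ^ 2 * (1 + X.opTime + X.sampleTime)

/-- Started with the numbers `n` and with strings encrypting `v`, the program `p` always halts
within the time `p.coef * ((K + 1) * X.timeUnit E)`, and the numbers and the encrypted elements
then satisfy `Q`. -/
def Runs (E K : ℕ) (p : BBProgram) (n : ℕ → ℕ) (v : ℕ → G) (Q : (ℕ → ℕ) → (ℕ → G) → Prop) :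
    Prop :=
  ∀ σ : BBState X.Codes, σ.num = n → (fun i => X.proj (σ.str i)) = v →
    p.coef * ((K + 1) * X.timeUnit E) ≤ σ.budget → ∀ o ∈ (X.exec p σ).support,
      ∃ τ, o = some τ ∧ σ.budget ≤ τ.budget + p.coef * ((K + 1) * X.timeUnit E) ∧
        Q τ.num fun i => X.proj (τ.str i)

variable {X} {E K : ℕ} {n : ℕ → ℕ} {v : ℕ → G} {Q R : (ℕ → ℕ) → (ℕ → G) → Prop}
  {p q : BBProgram} {a b c e : NumExpr}

theorem size_eval_le_timeUnit (hn : ∀ i, n i ≤ E) (e : NumExpr) :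
    (e.eval n).size ≤ e.coef * ((K + 1) * X.timeUnit E) := by
  refine (NumExpr.size_eval_le hn e).trans (Nat.mul_le_mul_left _ ?_)
  rw [timeUnit]
  calc E.size + 1 = 1 * ((E.size + 1) ^ 1 * 1) := by ring
    _ ≤ _ := by gcongr <;> omega

theorem cost_le_timeUnit (hn : ∀ i, n i ≤ E) (e : NumExpr) :
    e.cost n ≤ e.coef * ((K + 1) * X.timeUnit E) := by
  refine (NumExpr.cost_le hn e).trans (Nat.mul_le_mul_left _ ?_)
  rw [timeUnit]
  calc (E.size + 1) ^ 2 = 1 * ((E.size + 1) ^ 2 * 1) := by ring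
    _ ≤ _ := by gcongr <;> omega

theorem time_le_timeUnit : 1 + X.opTime + X.sampleTime ≤ (K + 1) * X.timeUnit E := by
  rw [timeUnit]
  calc 1 + X.opTime + X.sampleTime = 1 * (1 ^ 2 * (1 + X.opTime + X.sampleTime)) := by ring
    _ ≤ _ := by gcongr <;> omega

theorem Runs.imp (h : X.Runs E K p n v R) (hRQ : ∀ n v, R n v → Q n v) : X.Runs E K p n v Q := by
  intro σ h1 h2 h3 o ho
  obtain ⟨τ, e, hb, hR⟩ := h σ h1 h2 h3 o ho
  exact ⟨τ, e, hb, hRQ _ _ hR⟩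

theorem Runs.seq (h : X.Runs E K p n v fun n v => X.Runs E K q n v Q) :
    X.Runs E K (.seq p q) n v Q := by
  intro σ h1 h2 h3 o ho
  rw [BBProgram.coef, add_mul] at h3 ⊢
  rw [exec, BBState.andThen, PMF.mem_support_bind_iff] at ho
  obtain ⟨o', ho', ho⟩ := ho
  obtain ⟨τ, rfl, hb, hR⟩ := h σ h1 h2 (by omega) o' ho'
  obtain ⟨τ', rfl, hb', hQ⟩ := hR τ rfl rfl (by omega) o ho
  exact ⟨τ', rfl, by omega, hQ⟩

theorem runs_of_spend {cost : BBState X.Codes → ℕ}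
    {k : BBState X.Codes → BBState X.Codes → PMF (Option (BBState X.Codes))}
    (hp : ∀ σ, X.exec p σ = σ.spend (cost σ) (k σ))
    (hc : ∀ σ, σ.num = n → cost σ ≤ p.coef * ((K + 1) * X.timeUnit E))
    (hk : ∀ σ τ : BBState X.Codes, τ.num = n → (fun i => X.proj (τ.str i)) = v →
      ∀ o ∈ (k σ τ).support, ∃ τ', o = some τ' ∧ τ'.budget = τ.budget ∧
        Q τ'.num fun i => X.proj (τ'.str i)) : X.Runs E K p n v Q := by
  intro σ h1 h2 h3 o ho
  have h4 := hc σ h1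
  rw [hp, BBState.spend, if_pos (by omega)] at ho
  obtain ⟨τ, rfl, hb, hQ⟩ := hk σ _ (by exact h1) (by exact h2) o ho
  refine ⟨τ, rfl, ?_, hQ⟩
  rw [hb]
  simp only
  omega

theorem Runs.skip (h : Q n v) : X.Runs E K .skip n v Q := by
  refine runs_of_spend (fun σ => by rw [exec]) (fun σ _ => ?_) fun σ τ h1 h2 o ho => ?_
  · have := time_le_timeUnit (X := X) (E := E) (K := K)
    rw [BBProgram.coef]
    omega
  · rw [PMF.support_pure, Set.mem_singleton_iff] at ho
    exact ⟨τ, ho, rfl, by rw [h1, h2]; exact h⟩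

theorem Runs.set (hn : ∀ i, n i ≤ E)
    (h : Q (Function.update n (a.eval n) (e.eval n)) v) : X.Runs E K (.set a e) n v Q := by
  refine runs_of_spend (fun σ => by rw [exec]) (fun σ hσ => ?_) fun σ τ h1 h2 o ho => ?_
  · rw [hσ, BBProgram.coef]
    have := time_le_timeUnit (X := X) (E := E) (K := K)
    have h1 := size_eval_le_timeUnit (X := X) (K := K) hn a
    have h2 := size_eval_le_timeUnit (X := X) (K := K) hn e
    have h3 := cost_le_timeUnit (X := X) (K := K) hn a
    have h4 := cost_le_timeUnit (X := X) (K := K) hn e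
    nlinarith
  · rw [PMF.support_pure, Set.mem_singleton_iff] at ho
    refine ⟨_, ho, rfl, ?_⟩
    simp only [BBState.setNum, h1, h2]
    exact h

theorem proj_update_str (f : ℕ → X.Codes) (i : ℕ) (x : X.Codes) :
    (fun j => X.proj (Function.update f i x j)) =
      Function.update (fun j => X.proj (f j)) i (X.proj x) :=
  Function.comp_update X.proj f i x

theorem Runs.mul (hn : ∀ i, n i ≤ E)
    (h : Q n (Function.update v (a.eval n) (v (b.eval n) * v (c.eval n)))) :
    X.Runs E K (.mul a b c) n v Q := by
  refine runs_of_spend (fun σ => by rw [exec]) (fun σ hσ => ?_) fun σ τ h1 h2 o ho => ?_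
  · rw [hσ, BBProgram.coef]
    have := time_le_timeUnit (X := X) (E := E) (K := K)
    have h1 := cost_le_timeUnit (X := X) (K := K) hn a
    have h2 := cost_le_timeUnit (X := X) (K := K) hn b
    have h3 := cost_le_timeUnit (X := X) (K := K) hn c
    nlinarith
  · rw [PMF.support_map] at ho
    obtain ⟨x, hx, rfl⟩ := ho
    refine ⟨_, rfl, rfl, ?_⟩
    have := X.mul_spec _ _ x hx
    simp only [BBState.setStr, proj_update_str, this, h1]
    subst h2
    exact h

theorem Runs.inv (hn : ∀ i, n i ≤ E)
    (h : Q n (Function.update v (a.eval n) (v (b.eval n))⁻¹)) :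
    X.Runs E K (.inv a b) n v Q := by
  refine runs_of_spend (fun σ => by rw [exec]) (fun σ hσ => ?_) fun σ τ h1 h2 o ho => ?_
  · rw [hσ, BBProgram.coef]
    have := time_le_timeUnit (X := X) (E := E) (K := K)
    have h1 := cost_le_timeUnit (X := X) (K := K) hn a
    have h2 := cost_le_timeUnit (X := X) (K := K) hn b
    nlinarith
  · rw [PMF.support_map] at ho
    obtain ⟨x, hx, rfl⟩ := ho
    refine ⟨_, rfl, rfl, ?_⟩
    have := X.inv_spec _ x hx
    simp only [BBState.setStr, proj_update_str, this, h1]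
    subst h2
    exact h

theorem Runs.sample (hn : ∀ i, n i ≤ E) (h : ∀ g, Q n (Function.update v (a.eval n) g)) :
    X.Runs E K (.sample a) n v Q := by
  refine runs_of_spend (fun σ => by rw [exec]) (fun σ hσ => ?_) fun σ τ h1 h2 o ho => ?_
  · rw [hσ, BBProgram.coef]
    have := time_le_timeUnit (X := X) (E := E) (K := K)
    have h1 := cost_le_timeUnit (X := X) (K := K) hn a
    nlinarith
  · rw [PMF.support_map] at ho
    obtain ⟨x, hx, rfl⟩ := ho
    refine ⟨_, rfl, rfl, ?_⟩
    simp only [BBState.setStr, proj_update_str, h1, h2]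
    exact h _

open Classical in
theorem Runs.same (hn : ∀ i, n i ≤ E)
    (h : Q (Function.update n (a.eval n) (if v (b.eval n) = v (c.eval n) then 1 else 0)) v) :
    X.Runs E K (.same a b c) n v Q := by
  refine runs_of_spend (fun σ => by rw [exec]) (fun σ hσ => ?_) fun σ τ h1 h2 o ho => ?_
  · rw [hσ, BBProgram.coef]
    have := time_le_timeUnit (X := X) (E := E) (K := K)
    have h1 := cost_le_timeUnit (X := X) (K := K) hn a
    have h2 := cost_le_timeUnit (X := X) (K := K) hn b
    have h3 := cost_le_timeUnit (X := X) (K := K) hn c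
    nlinarith
  · rw [PMF.support_pure, Set.mem_singleton_iff] at ho
    refine ⟨_, ho, rfl, ?_⟩
    simp only [BBState.setNum, h1]
    subst h2
    exact h

theorem Runs.branch (hn : ∀ i, n i ≤ E) (hp : e.eval n ≠ 0 → X.Runs E K p n v Q)
    (hq : e.eval n = 0 → X.Runs E K q n v Q) : X.Runs E K (.branch e p q) n v Q := by
  intro σ h1 h2 h3 o ho
  have h4 := cost_le_timeUnit (X := X) (K := K) hn e
  rw [BBProgram.coef, add_mul, add_mul] at h3 ⊢
  rw [exec, BBState.spend, if_pos (by rw [h1]; omega)] at ho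
  simp only [h1] at ho
  split_ifs at ho with h
  · obtain ⟨τ, rfl, hb, hQ⟩ := hq h { σ with budget := σ.budget - e.cost n, num := n } rfl h2
      (by simp only; omega) o ho
    exact ⟨τ, rfl, by simp only at hb; omega, hQ⟩
  · obtain ⟨τ, rfl, hb, hQ⟩ := hp h { σ with budget := σ.budget - e.cost n, num := n } rfl h2
      (by simp only; omega) o ho
    exact ⟨τ, rfl, by simp only at hb; omega, hQ⟩

/-- The index k of the invariant bounds the number of passes still to come, and `m` bounds the
number of tests; k < m leaves room for the final failing test. The body is charged with K = 0, so k
+ 1 rounds fit into the stated time. -/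
theorem iter_spec (I : ℕ → (ℕ → ℕ) → (ℕ → G) → Prop) (hI : ∀ k n v, I k n v → ∀ i, n i ≤ E)
    (hstep : ∀ k n v, I k n v → e.eval n ≠ 0 → ∃ k', k = k' + 1 ∧ X.Runs E 0 p n v (I k'))
    (hexit : ∀ k n v, I k n v → e.eval n = 0 → Q n v) (m : ℕ) :
    ∀ (k : ℕ) (σ : BBState X.Codes), I k σ.num (fun i => X.proj (σ.str i)) → k < m →
      (e.coef + p.coef) * ((k + 1) * X.timeUnit E) ≤ σ.budget →
      ∀ o ∈ (BBState.iter e (X.exec p) m σ).support, ∃ τ, o = some τ ∧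
        σ.budget ≤ τ.budget + (e.coef + p.coef) * ((k + 1) * X.timeUnit E) ∧
        Q τ.num fun i => X.proj (τ.str i) := by
  induction m with
  | zero => intro k σ _ hk; omega
  | succ m ih =>
    intro k σ hσ hk hb o ho
    have h4 := cost_le_timeUnit (X := X) (K := 0) (hI _ _ _ hσ) e
    have h5 : p.coef * ((0 + 1) * X.timeUnit E) + e.coef * ((0 + 1) * X.timeUnit E) ≤
        (e.coef + p.coef) * ((k + 1) * X.timeUnit E) := by
      rw [← add_mul, add_comm p.coef]
      gcongr
      omega
    rw [BBState.iter, BBState.spend, if_pos (by omega)] at ho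
    simp only at ho
    split_ifs at ho with h
    · rw [PMF.support_pure, Set.mem_singleton_iff] at ho
      refine ⟨_, ho, ?_, hexit _ _ _ hσ h⟩
      simp only
      omega
    · obtain ⟨k', rfl, hp⟩ := hstep _ _ _ hσ h
      rw [BBState.andThen, PMF.mem_support_bind_iff] at ho
      obtain ⟨o', ho', ho⟩ := ho
      obtain ⟨τ, rfl, hb1, hτ⟩ := hp { σ with budget := σ.budget - e.cost σ.num } rfl rfl
        (by simp only; omega) o' ho'
      simp only at hb1
      have h6 : (e.coef + p.coef) * ((k' + 1 + 1) * X.timeUnit E) =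
          (e.coef + p.coef) * ((k' + 1) * X.timeUnit E) +
            (p.coef * ((0 + 1) * X.timeUnit E) + e.coef * ((0 + 1) * X.timeUnit E)) := by ring
      obtain ⟨τ', rfl, hb2, hQ⟩ := ih k' τ hτ (by omega) (by omega) o ho
      exact ⟨τ', rfl, by omega, hQ⟩

theorem Runs.loop (I : ℕ → (ℕ → ℕ) → (ℕ → G) → Prop) (hI : ∀ k n v, I k n v → ∀ i, n i ≤ E)
    (hstep : ∀ k n v, I k n v → e.eval n ≠ 0 → ∃ k', k = k' + 1 ∧ X.Runs E 0 p n v (I k'))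
    (hexit : ∀ k n v, I k n v → e.eval n = 0 → Q n v) (h : I K n v) :
    X.Runs E K (.loop e p) n v Q := by
  rintro σ rfl rfl h3 o ho
  rw [exec] at ho
  rw [BBProgram.coef] at h3 ⊢
  -- The time unit is positive, so the budget is at least K + 1 and the allowance of budget + 1
  -- tests exceeds K.
  refine iter_spec I hI hstep hexit _ K σ h ?_ h3 o ho
  have h1 := time_le_timeUnit (X := X) (E := E) (K := 0)
  have h2 := e.one_le_coef
  have : 1 * ((K + 1) * 1) ≤ (e.coef + p.coef) * ((K + 1) * X.timeUnit E) := by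
    gcongr <;> omega
  omega

end BlackBoxGroup

/-! ### The program. -/

namespace BBProgram

/-- The parity of the number in cell `i`. -/
def parity (i : ℕ) : NumExpr :=
  .sub (.get (.lit i)) (.mul (.div (.get (.lit i)) (.lit 2)) (.lit 2))

/-- `num[i] := num[i] / 2` -/
def halve (i : ℕ) : BBProgram := .set (.lit i) (.div (.get (.lit i)) (.lit 2))

/-- `str[a] := str[b] * str[c]` for fixed addresses. -/
abbrev mulCells (a b c : ℕ) : BBProgram := .mul (.lit a) (.lit b) (.lit c)

/-- `num[a] := 1` or `0` according to whether `str[b]` and `str[c]` encrypt the same element, for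
fixed addresses. -/
abbrev sameCells (a b c : ℕ) : BBProgram := .same (.lit a) (.lit b) (.lit c)

/-- Replace the number in cell `0` by `(m + 1) / 2`, where `m` is its greatest odd divisor. -/
def oddHalf : BBProgram :=
  .seq (.loop (.sub (.lit 1) (parity 0)) (halve 0))
    (.set (.lit 0) (.div (.add (.get (.lit 0)) (.lit 1)) (.lit 2)))

/-- Square and multiply: `str[6] := str[5] ^ num[0]`, with the identity element in cell `2`. -/
def power : BBProgram :=
  .seq (.set (.lit 1) (.get (.lit 0))) <| .seq (mulCells 6 2 2) <|
    .loop (.get (.lit 1)) <| .seq (.branch (parity 1) (mulCells 6 6 5) .skip) <|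
      .seq (mulCells 5 5 5) (halve 1)

/-- `str[6] :=` the dihedral midpoint of `str[a]` and `str[b]`. -/
def mid (a b : ℕ) : BBProgram :=
  .seq (mulCells 5 a b) <| .seq power (mulCells 6 a 6)

/-- If `str[c]` is an involution which commutes with `str[0]` and `str[1]` and is different from
both, then copy it to cell `3`. -/
def check (c : ℕ) : BBProgram :=
  .seq (sameCells 2 c 2) <|
  .seq (mulCells 7 c c) <| .seq (sameCells 3 7 2) <|
  .seq (mulCells 7 c 0) <| .seq (mulCells 8 0 c) <| .seq (sameCells 4 7 8) <|
  .seq (mulCells 7 c 1) <| .seq (mulCells 8 1 c) <| .seq (sameCells 5 7 8) <|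
  .seq (sameCells 6 c 0) <| .seq (sameCells 7 c 1) <|
  .branch (.mul (.sub (.lit 1) (.get (.lit 2))) <| .mul (.get (.lit 3)) <|
      .mul (.get (.lit 4)) <| .mul (.get (.lit 5)) <|
      .mul (.sub (.lit 1) (.get (.lit 6))) (.sub (.lit 1) (.get (.lit 7))))
    (mulCells 3 c 2) .skip

/-- Check the random string in cell `4` and the candidate computed from it. -/
def attempt : BBProgram :=
  .seq (check 4) <| .seq (.inv (.lit 9) (.lit 4)) <| .seq (mulCells 9 9 0) <|
  .seq (mulCells 9 9 4) <| .seq (mid 0 9) <| .seq (mulCells 10 4 6) <|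
  .seq (.inv (.lit 9) (.lit 10)) <| .seq (mulCells 9 9 1) <| .seq (mulCells 9 9 10) <|
  .seq (mid 1 9) <| .seq (mulCells 10 10 6) (check 10)

/-- `k` independent attempts. -/
def attempts : ℕ → BBProgram
  | 0 => .skip
  | k + 1 => .seq (.seq (.sample (.lit 4)) attempt) (attempts k)

/-- Put the identity into cell `2`, check the first two powers of `st`, and compute the exponent
for the dihedral midpoints. -/
def prepare : BBProgram :=
  .seq (mulCells 2 0 0) <| .seq (mulCells 10 0 1) <| .seq (check 10) <|
  .seq (mulCells 10 10 10) <| .seq (check 10) oddHalf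

/-- The algorithm, with `k` attempts. -/
def findCommutingInvolution (k : ℕ) : BBProgram :=
  .seq prepare <| .seq (attempts k) (mulCells 0 3 2)

end BBProgram

/-! ### Correctness and termination of the subprograms. -/

namespace BlackBoxGroup

open BBProgram

variable {G : Type*} [Group G] [Finite G] {X : BlackBoxGroup G} {E K M : ℕ} {n : ℕ → ℕ}
  {v : ℕ → G} {Q : (ℕ → ℕ) → (ℕ → G) → Prop}

theorem update_le {a x : ℕ} (hn : ∀ i, n i ≤ E) (hx : x ≤ E) (i : ℕ) :
    Function.update n a x i ≤ E := by
  rw [Function.update_apply]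
  split_ifs
  · exact hx
  · exact hn i

theorem eval_parity (i : ℕ) : (parity i).eval n = n i % 2 := by
  simp only [parity, NumExpr.eval]
  omega

theorem size_half_lt {x : ℕ} (hx : x ≠ 0) : (x / 2).size < x.size := by
  have h1 : 0 < x.size := Nat.size_pos.2 (Nat.pos_of_ne_zero hx)
  have h2 := Nat.lt_size_self x
  have : (x / 2).size ≤ x.size - 1 := by
    rw [Nat.size_le]
    obtain ⟨y, hy⟩ : ∃ y, x.size = y + 1 := ⟨x.size - 1, by omega⟩
    rw [hy] at h2 ⊢
    rw [pow_succ] at h2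
    simp only [Nat.add_sub_cancel]
    omega
  omega

theorem runs_oddHalf (hn : ∀ i, n i ≤ E) (hE : n 0 = E) (hE0 : 0 < E)
    (h : ∀ M ≤ E, (∃ k m, Odd m ∧ 2 ^ k * m = E ∧ 2 * M = m + 1) →
      Q (Function.update n 0 M) v) :
    X.Runs E E.size oddHalf n v Q := by
  -- Invariant: the current number times a power of two is E. Its bit length bounds the remaining
  -- passes, since halving a positive number shortens it.
  refine Runs.seq (Runs.loop (fun k n' v' => v' = v ∧ ∃ x j, n' = Function.update n 0 x ∧
    0 < x ∧ 2 ^ j * x = E ∧ x.size ≤ k) ?_ ?_ ?_ ?_)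
  · rintro k n' v' ⟨-, x, j, rfl, h0, hx, -⟩
    exact update_le hn (by rw [← hx]; exact Nat.le_mul_of_pos_left _ (by positivity))
  · rintro k n' v' ⟨rfl, x, j, rfl, h0, hx, hk⟩ he
    have hxE : x ≤ E := by rw [← hx]; exact Nat.le_mul_of_pos_left _ (by positivity)
    simp only [NumExpr.eval, eval_parity, Function.update_self] at he
    have hlt := size_half_lt h0.ne'
    refine ⟨k - 1, by omega, Runs.set (update_le hn hxE) ⟨rfl, x / 2, j + 1, ?_, by omega, ?_,
      by omega⟩⟩
    · simp [NumExpr.eval]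
    · rw [pow_succ, mul_assoc, ← hx]
      congr 1
      omega
  · rintro k n' v' ⟨rfl, x, j, rfl, h0, hx, hk⟩ he
    have hxE : x ≤ E := by rw [← hx]; exact Nat.le_mul_of_pos_left _ (by positivity)
    simp only [NumExpr.eval, eval_parity, Function.update_self] at he
    refine Runs.set (update_le hn hxE) ?_
    have := h ((x + 1) / 2) (by omega) ⟨j, x, Nat.odd_iff.2 (by omega), hx, by omega⟩
    simpa [NumExpr.eval] using this
  · refine ⟨rfl, E, 0, ?_, hE0, by simp, le_rfl⟩
    rw [← hE, Function.update_eq_self]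

theorem runs_power (hn : ∀ i, n i ≤ E) (hM : n 0 = M) (h1 : v 2 = 1)
    (h : ∀ n' v', (∀ i, n' i ≤ E) → (∀ i, i ≠ 1 → n' i = n i) →
      (∀ i, i ≠ 5 → i ≠ 6 → v' i = v i) → v' 6 = v 5 ^ M → Q n' v') :
    X.Runs E E.size power n v Q := by
  refine Runs.seq (Runs.set hn ?_)
  simp only [NumExpr.eval, hM]
  have hME : M ≤ E := hM ▸ hn 0
  refine Runs.seq (Runs.mul (update_le hn hME) ?_)
  simp only [NumExpr.eval, h1, mul_one]
  -- Square-and-multiply invariant: accumulator times base to the remaining exponent is the required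
  -- power.
  refine Runs.loop (fun k n' v' => (∀ i, n' i ≤ E) ∧ (∀ i, i ≠ 1 → n' i = n i) ∧
    (∀ i, i ≠ 5 → i ≠ 6 → v' i = v i) ∧ v' 6 * v' 5 ^ n' 1 = v 5 ^ M ∧ (n' 1).size ≤ k)
    (fun k n' v' h => h.1) ?_ ?_ ?_
  · rintro k n' v' ⟨hn', hf, hv, hpow, hk⟩ he
    simp only [NumExpr.eval] at he
    have hlt := size_half_lt he
    refine ⟨k - 1, by omega, Runs.seq ?_⟩
    refine Runs.branch hn' ?_ ?_
    all_goals
      intro hpar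
      rw [eval_parity] at hpar
    · refine Runs.mul hn' (Runs.seq (Runs.mul hn' (Runs.set hn' ?_)))
      refine ⟨update_le hn' ?_, ?_, ?_, ?_, ?_⟩
      · simp only [NumExpr.eval]; have := hn' 1; omega
      · intro i hi; simp [NumExpr.eval, hi, hf]
      · intro i h5 h6; simp [NumExpr.eval, h5, h6, hv]
      · simp only [NumExpr.eval, Function.update_self, ne_eq, Nat.reduceEqDiff, not_false_eq_true,
          Function.update_of_ne]
        rw [← hpow]
        have e : n' 1 = 1 + 2 * (n' 1 / 2) := by omega
        conv_rhs => rw [e, pow_add, pow_one, pow_mul, ← mul_assoc, sq]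
      · simp only [NumExpr.eval, Function.update_self]; omega
    · refine Runs.skip (Runs.seq (Runs.mul hn' (Runs.set hn' ?_)))
      refine ⟨update_le hn' ?_, ?_, ?_, ?_, ?_⟩
      · simp only [NumExpr.eval]; have := hn' 1; omega
      · intro i hi; simp [NumExpr.eval, hi, hf]
      · intro i h5 h6; simp [NumExpr.eval, h5, hv, h6]
      · simp only [NumExpr.eval, Function.update_self, ne_eq, Nat.reduceEqDiff, not_false_eq_true,
          Function.update_of_ne]
        rw [← hpow]
        have e : n' 1 = 2 * (n' 1 / 2) := by omega
        conv_rhs => rw [e, pow_mul, sq]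
      · simp only [NumExpr.eval, Function.update_self]; omega
  · rintro k n' v' ⟨hn', hf, hv, hpow, -⟩ he
    simp only [NumExpr.eval] at he
    rw [he, pow_zero, mul_one] at hpow
    exact h n' v' hn' hf hv hpow
  · refine ⟨update_le hn hME, ?_, ?_, ?_, ?_⟩
    · intro i hi; simp [hi]
    · intro i _ h6; simp [h6]
    · simp
    · simp only [Function.update_self]; exact Nat.size_le_size hME

theorem runs_mid {a b : ℕ} (ha5 : a ≠ 5) (ha6 : a ≠ 6) (hn : ∀ i, n i ≤ E) (hM : n 0 = M)
    (h1 : v 2 = 1)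
    (h : ∀ n' v', (∀ i, n' i ≤ E) → n' 0 = M →
      (∀ i, i ≠ 5 → i ≠ 6 → v' i = v i) → v' 6 = dihedralMidpoint M (v a) (v b) → Q n' v') :
    X.Runs E E.size (mid a b) n v Q := by
  refine Runs.seq (Runs.mul hn (Runs.seq (runs_power hn hM (by simpa [NumExpr.eval] using h1) ?_)))
  intro n' v' hn' hf hv hp
  refine Runs.mul hn' (h _ _ hn' (by rw [hf 0 (by omega), hM]) ?_ ?_)
  · intro i h5 h6
    simp [NumExpr.eval, h6, hv i h5 h6, h5]
  · simp only [NumExpr.eval, Function.update_self] at hp ⊢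
    rw [hp, hv a ha5 ha6]
    simp [NumExpr.eval, dihedralMidpoint, ha5]

/-- The test is exact, which makes the error one-sided: a correct value in cell `3` can be
overwritten only by a correct value. Positivity of E keeps the stored bits below the bound E. -/
theorem runs_check {c : ℕ} (h7 : c ≠ 7) (h8 : c ≠ 8) (hE : 0 < E)
    (hn : ∀ i, n i ≤ E) (h1 : v 2 = 1)
    (h : ∀ n' v', (∀ i, n' i ≤ E) → n' 0 = n 0 →
      (∀ i, i ≠ 3 → i ≠ 7 → i ≠ 8 → v' i = v i) →
      (IsCommutingInvolution (v 0) (v 1) (v 3) ∨ IsCommutingInvolution (v 0) (v 1) (v c) →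
        IsCommutingInvolution (v 0) (v 1) (v' 3)) → Q n' v') :
    X.Runs E K (check c) n v Q := by
  classical
  have hif : ∀ p : Prop, (if p then 1 else 0 : ℕ) ≤ E := fun p => by split_ifs <;> omega
  refine .seq (.same ?_ <| .seq <| .mul ?_ <| .seq <| .same ?_ <| .seq <| .mul ?_ <| .seq <|
    .mul ?_ <| .seq <| .same ?_ <| .seq <| .mul ?_ <| .seq <| .mul ?_ <| .seq <| .same ?_ <|
    .seq <| .same ?_ <| .seq <| .same ?_ <| .branch ?_ ?pos ?neg)
  case pos =>
    intro he
    refine Runs.mul ?_ (h _ _ ?_ ?_ ?_ ?_)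
    case refine_3 => simp [NumExpr.eval]
    case refine_4 =>
      intro i h3 h7 h8
      simp [NumExpr.eval, h3, h7, h8]
    case refine_5 =>
      simp [NumExpr.eval, h7, h8, h1] at he ⊢
      obtain ⟨e1, e2, e3, e4, e5, e6⟩ := he
      intro _
      -- A nonzero product of the stored bits means that every single test was passed.
      refine ⟨orderOf_eq_prime (by rw [sq, e3]) fun h => e4 (by simp [h]),
        fun h => e5 (by simp [h]), fun h => e6 (by simp [h]), e2, e1⟩
    all_goals
      repeat' (first | exact hn | exact hif _ | apply update_le)
  case neg =>
    intro he
    refine Runs.skip (h _ _ ?_ ?_ ?_ ?_)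
    case refine_2 => simp [NumExpr.eval]
    case refine_3 =>
      intro i h3 h7 h8
      simp [NumExpr.eval, h7, h8]
    case refine_4 =>
      intro hor
      rcases hor with hC | ⟨ho, hC1, hC2, hC3, hC4⟩
      · simpa [NumExpr.eval] using hC
      · exfalso
        have e1 : v c * v c = 1 := by rw [← sq, ← ho, pow_orderOf_eq_one]
        have e2 : v c ≠ 1 := by intro h; simp [h] at ho
        simp [NumExpr.eval, h7, h8, h1, e1, e2, hC1, hC2, hC3.eq, hC4.eq] at he
    all_goals
      repeat' (first | exact hn | exact hif _ | apply update_le)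
  all_goals
    repeat' (first | exact hn | exact hif _ | apply update_le)

/-- The state between two attempts. -/
def Prepared (E M : ℕ) (s t : G) (n : ℕ → ℕ) (v : ℕ → G) : Prop :=
  (∀ i, n i ≤ E) ∧ n 0 = M ∧ v 0 = s ∧ v 1 = t ∧ v 2 = 1

theorem runs_attempt {s t : G} (hE : 0 < E) (h : Prepared E M s t n v) :
    X.Runs E E.size attempt n v fun n' v' => Prepared E M s t n' v' ∧
      (IsCommutingInvolution s t (v 3) ∨ IsCommutingInvolution s t (v 4) ∨
        IsCommutingInvolution s t (candidate M s t (v 4)) →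
          IsCommutingInvolution s t (v' 3)) := by
  obtain ⟨hn, hM, rfl, rfl, h2⟩ := h
  refine Runs.seq (runs_check (by omega) (by omega) hE hn h2 ?_)
  intro n₁ v₁ hn₁ hM₁ hf₁ hw₁
  have hv0 : v₁ 0 = v 0 := hf₁ 0 (by omega) (by omega) (by omega)
  have hv1 : v₁ 1 = v 1 := hf₁ 1 (by omega) (by omega) (by omega)
  have hv2 : v₁ 2 = 1 := by rw [hf₁ 2 (by omega) (by omega) (by omega), h2]
  have hv4 : v₁ 4 = v 4 := hf₁ 4 (by omega) (by omega) (by omega)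
  refine .seq <| .inv hn₁ <| .seq <| .mul hn₁ <| .seq <| .mul hn₁ <| .seq ?_
  simp only [NumExpr.eval]
  refine runs_mid (by omega) (by omega) hn₁ (by rw [hM₁, hM]) (by simp [hv2]) ?_
  intro n₂ v₂ hn₂ hM₂ hf₂ hm₂
  have g0 : v₂ 0 = v 0 := by rw [hf₂ 0 (by omega) (by omega)]; simp [hv0]
  have g1 : v₂ 1 = v 1 := by rw [hf₂ 1 (by omega) (by omega)]; simp [hv1]
  have g2 : v₂ 2 = 1 := by rw [hf₂ 2 (by omega) (by omega)]; simp [hv2]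
  have g3 : v₂ 3 = v₁ 3 := by rw [hf₂ 3 (by omega) (by omega)]; simp
  have g4 : v₂ 4 = v 4 := by rw [hf₂ 4 (by omega) (by omega)]; simp [hv4]
  refine .seq <| .mul hn₂ <| .seq <| .inv hn₂ <| .seq <| .mul hn₂ <| .seq <| .mul hn₂ <| .seq ?_
  simp only [NumExpr.eval]
  refine runs_mid (by omega) (by omega) hn₂ hM₂ (by simp [g2]) ?_
  intro n₃ v₃ hn₃ hM₃ hf₃ hm₃
  have k0 : v₃ 0 = v 0 := by rw [hf₃ 0 (by omega) (by omega)]; simp [g0]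
  have k1 : v₃ 1 = v 1 := by rw [hf₃ 1 (by omega) (by omega)]; simp [g1]
  have k2 : v₃ 2 = 1 := by rw [hf₃ 2 (by omega) (by omega)]; simp [g2]
  have k3 : v₃ 3 = v₁ 3 := by rw [hf₃ 3 (by omega) (by omega)]; simp [g3]
  have k10 : v₃ 10 * v₃ 6 = candidate M (v 0) (v 1) (v 4) := by
    rw [hf₃ 10 (by omega) (by omega), hm₃]
    simp [hm₂, g4, g1, hv0, hv4, candidate]
  refine .seq <| .mul hn₃ ?_
  simp only [NumExpr.eval, k10]
  refine runs_check (by omega) (by omega) hE hn₃ (by simp [k2]) ?_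
  intro n₄ v₄ hn₄ hM₄ hf₄ hw₄
  simp only [Function.update_self, ne_eq, Nat.reduceEqDiff, OfNat.zero_ne_ofNat,
    OfNat.one_ne_ofNat, not_false_eq_true, Function.update_of_ne, k0, k1, k3] at hw₄
  refine ⟨⟨hn₄, by rw [hM₄, hM₃], ?_, ?_, ?_⟩, ?_⟩
  · rw [hf₄ 0 (by omega) (by omega) (by omega)]; simp [k0]
  · rw [hf₄ 1 (by omega) (by omega) (by omega)]; simp [k1]
  · rw [hf₄ 2 (by omega) (by omega) (by omega)]; simp [k2]
  · rintro (h | h | h)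
    · exact hw₄ (Or.inl (hw₁ (Or.inl h)))
    · exact hw₄ (Or.inl (hw₁ (Or.inr h)))
    · exact hw₄ (Or.inr h)

theorem runs_attempts {s t : G} (hE : 0 < E) (k : ℕ) (h : Prepared E M s t n v) :
    X.Runs E E.size (attempts k) n v fun n' v' => Prepared E M s t n' v' ∧
      (IsCommutingInvolution s t (v 3) → IsCommutingInvolution s t (v' 3)) := by
  induction k generalizing n v with
  | zero => exact Runs.skip ⟨h, id⟩
  | succ k ih =>
    refine Runs.seq (Runs.seq (Runs.sample h.1 fun g => ?_))
    have h' : Prepared E M s t n (Function.update v 4 g) := by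
      obtain ⟨h1, h2, h3, h4, h5⟩ := h
      exact ⟨h1, h2, by simp [h3], by simp [h4], by simp [h5]⟩
    refine (runs_attempt hE h').imp fun n' v' hn' => (ih hn'.1).imp fun n'' v'' hn'' =>
      ⟨hn''.1, fun hC => hn''.2 (hn'.2 (Or.inl ?_))⟩
    simpa using hC

/-- The identity is obtained as s². If j is st or (st)², it is already stored here, and no random
element is needed. -/
theorem runs_prepare (hn : ∀ i, n i ≤ E) (hE : n 0 = E) (hE0 : 0 < E) (h1 : v 0 * v 0 = 1) :
    X.Runs E E.size prepare n v fun n' v' =>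
      ∃ M, (∃ k m, Odd m ∧ 2 ^ k * m = E ∧ 2 * M = m + 1) ∧ Prepared E M (v 0) (v 1) n' v' ∧
        (IsCommutingInvolution (v 0) (v 1) (v 0 * v 1) ∨
          IsCommutingInvolution (v 0) (v 1) ((v 0 * v 1) * (v 0 * v 1)) →
            IsCommutingInvolution (v 0) (v 1) (v' 3)) := by
  refine .seq <| .mul hn <| .seq <| .mul hn <| .seq ?_
  simp only [NumExpr.eval, h1]
  refine runs_check (by omega) (by omega) hE0 hn (by simp) ?_
  intro n₁ v₁ hn₁ hM₁ hf₁ hw₁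
  have hv0 : v₁ 0 = v 0 := by rw [hf₁ 0 (by omega) (by omega) (by omega)]; simp
  have hv1 : v₁ 1 = v 1 := by rw [hf₁ 1 (by omega) (by omega) (by omega)]; simp
  have hv2 : v₁ 2 = 1 := by rw [hf₁ 2 (by omega) (by omega) (by omega)]; simp
  have hv10 : v₁ 10 = v 0 * v 1 := by rw [hf₁ 10 (by omega) (by omega) (by omega)]; simp
  refine .seq <| .mul hn₁ <| .seq ?_
  simp only [NumExpr.eval, hv10]
  refine runs_check (by omega) (by omega) hE0 hn₁ (by simp [hv2]) ?_
  intro n₂ v₂ hn₂ hM₂ hf₂ hw₂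
  refine runs_oddHalf hn₂ (by rw [hM₂, hM₁, hE]) hE0 fun M hM hkm =>
    ⟨M, hkm, ⟨update_le hn₂ hM, by simp, ?_, ?_, ?_⟩, ?_⟩
  · rw [hf₂ 0 (by omega) (by omega) (by omega)]; simp [hv0]
  · rw [hf₂ 1 (by omega) (by omega) (by omega)]; simp [hv1]
  · rw [hf₂ 2 (by omega) (by omega) (by omega)]; simp [hv2]
  · simp only [Function.update_self, ne_eq, Nat.reduceEqDiff, OfNat.zero_ne_ofNat,
      OfNat.one_ne_ofNat, not_false_eq_true, Function.update_of_ne, hv0, hv1] at hw₁ hw₂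
    rintro (h | h)
    · exact hw₂ (Or.inl (hw₁ (Or.inr h)))
    · exact hw₂ (Or.inr h)

end BlackBoxGroup

/-! ### Failure probabilities. -/

open scoped ENNReal

theorem PMF.toOuterMeasure_apply_le_one {α : Type*} (p : PMF α) (s : Set α) :
    p.toOuterMeasure s ≤ 1 := by
  rw [← (p.toOuterMeasure_apply_eq_one_iff Set.univ).2 (Set.subset_univ _)]
  exact MeasureTheory.measure_mono (Set.subset_univ s)

theorem PMF.toOuterMeasure_add_compl {α : Type*} (p : PMF α) (s : Set α) :
    p.toOuterMeasure s + p.toOuterMeasure sᶜ = 1 := by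
  rw [PMF.toOuterMeasure_apply, PMF.toOuterMeasure_apply, ← ENNReal.tsum_add, ← p.tsum_coe]
  exact tsum_congr fun x => congrFun (Set.indicator_self_add_compl s p) x

/-- An odd divisor of E divides the odd part m of E, and 2M = m + 1. -/
theorem pow_eq_self_of_odd_orderOf {G : Type*} [Group G] {E M : ℕ} {x : G} (hx : x ^ E = 1) (hodd : Odd (orderOf x))
    (hM : ∃ k m, Odd m ∧ 2 ^ k * m = E ∧ 2 * M = m + 1) : x ^ (2 * M) = x := by
  obtain ⟨k, m, -, rfl, hM⟩ := hM
  have hd : orderOf x ∣ m :=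
    (Nat.Coprime.pow_right k hodd.coprime_two_right).dvd_of_dvd_mul_left
      (orderOf_dvd_of_pow_eq_one hx)
  rw [hM, pow_succ, orderOf_dvd_iff_pow_eq_one.1 hd, one_mul]

namespace BlackBoxGroup

open BBProgram

variable {G : Type*} [Group G] [Finite G] (X : BlackBoxGroup G)

theorem ofReal_le_map_sample (g : G) :
    ENNReal.ofReal (1 / (2 * (Nat.card G : ℝ))) ≤ (X.sample.map X.proj) g := by
  rw [ENNReal.ofReal_le_iff_le_toReal (PMF.apply_ne_top _ _)]
  have h := (abs_le.1 (X.sample_nearly_uniform g)).1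
  have e : 1 / (Nat.card G : ℝ) = 2 * (1 / (2 * (Nat.card G : ℝ))) := by
    have : (Nat.card G : ℝ) ≠ 0 := by exact_mod_cast Nat.card_pos.ne'
    field_simp
  linarith

theorem proj_surjective : Function.Surjective X.proj := by
  intro g
  have h : g ∈ (X.sample.map X.proj).support := by
    rw [PMF.mem_support_iff]
    refine (lt_of_lt_of_le ?_ (X.ofReal_le_map_sample g)).ne'
    rw [ENNReal.ofReal_pos]
    have : (0 : ℝ) < Nat.card G := by exact_mod_cast Nat.card_pos
    positivity
  rw [PMF.support_map] at h
  obtain ⟨x, -, hx⟩ := h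
  exact ⟨x, hx⟩

/-- Near uniformity costs a factor 2: each element has probability at least 1/(2|G|), so a subset of
density at least 1/D is hit with probability at least 1/(2D). -/
theorem toOuterMeasure_map_sample_le {D : ℕ} (hD : 0 < D) {P : G → Prop}
    (h : Nat.card G ≤ D * Nat.card {g // P g}) :
    (X.sample.map X.proj).toOuterMeasure {g | ¬ P g} ≤
      1 - ENNReal.ofReal (1 / (2 * (D : ℝ))) := by
  classical
  have := Fintype.ofFinite G
  have hc : (0 : ℝ) < Nat.card G := by exact_mod_cast Nat.card_pos
  have hle : ENNReal.ofReal (1 / (2 * (D : ℝ))) ≤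
      (X.sample.map X.proj).toOuterMeasure {g | P g} := by
    have e : {g | P g} = ((Finset.univ.filter P : Finset G) : Set G) := by ext; simp
    rw [e, PMF.toOuterMeasure_apply_finset]
    refine le_trans ?_ (Finset.card_nsmul_le_sum _ _ _ fun g _ => X.ofReal_le_map_sample g)
    rw [nsmul_eq_mul, ← ENNReal.ofReal_natCast, ← ENNReal.ofReal_mul (by positivity)]
    apply ENNReal.ofReal_le_ofReal
    rw [Nat.card_eq_fintype_card (α := {g // P g}), Fintype.card_subtype] at h
    have h' : (Nat.card G : ℝ) ≤ D * (Finset.univ.filter P).card := by exact_mod_cast h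
    have hD' : (0 : ℝ) < D := by exact_mod_cast hD
    rw [mul_one_div, div_le_div_iff₀ (by positivity) (by positivity)]
    linarith
  have hadd := (X.sample.map X.proj).toOuterMeasure_add_compl {g | P g}
  refine ENNReal.le_sub_of_add_le_left ENNReal.ofReal_ne_top ?_
  rw [← hadd]
  exact add_le_add hle le_rfl

variable {X} {E M : ℕ} {s t : G} {p q : BBProgram}

/-- Conditioning on the outcome of `p`: outcomes in S contribute at most their mass times ε, the
others nothing. Thus the failure bounds of successive trials multiply. -/
theorem toOuterMeasure_exec_seq_le {σ : BBState X.Codes} {S S' : Set (Option (BBState X.Codes))}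
    {ε : ℝ≥0∞} (h1 : ∀ o ∈ (X.exec p σ).support, o ∈ S →
      (o.elim (PMF.pure none) (X.exec q)).toOuterMeasure S' ≤ ε)
    (h2 : ∀ o ∈ (X.exec p σ).support, o ∉ S →
      (o.elim (PMF.pure none) (X.exec q)).toOuterMeasure S' = 0) :
    (X.exec (.seq p q) σ).toOuterMeasure S' ≤ (X.exec p σ).toOuterMeasure S * ε := by
  rw [exec, BBState.andThen, PMF.toOuterMeasure_bind_apply, PMF.toOuterMeasure_apply,
    ← ENNReal.tsum_mul_right]
  refine ENNReal.tsum_le_tsum fun o => ?_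
  by_cases ho : o ∈ (X.exec p σ).support
  · by_cases hS : o ∈ S
    · rw [Set.indicator_of_mem hS]
      gcongr
      exact h1 o ho hS
    · rw [h2 o ho hS, mul_zero]
      exact zero_le
  · rw [PMF.mem_support_iff, not_not] at ho
    rw [ho, zero_mul]
    exact zero_le

/-- The outcomes which have not stored the commuting involution of `s` and `t` in cell `i`. -/
def Failed (X : BlackBoxGroup G) (s t : G) (i : ℕ) : Set (Option (BBState X.Codes)) :=
  {o | ∀ τ, o = some τ → ¬ IsCommutingInvolution s t (X.proj (τ.str i))}

theorem toOuterMeasure_failed_eq_zero {σ : BBState X.Codes} {i : ℕ}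
    {Q : (ℕ → ℕ) → (ℕ → G) → Prop} {K : ℕ}
    (h : X.Runs E K p σ.num (fun i => X.proj (σ.str i)) Q)
    (hb : p.coef * ((K + 1) * X.timeUnit E) ≤ σ.budget)
    (hQ : ∀ n v, Q n v → IsCommutingInvolution s t (v i)) :
    (X.exec p σ).toOuterMeasure (X.Failed s t i) = 0 := by
  rw [PMF.toOuterMeasure_apply_eq_zero_iff, Set.disjoint_left]
  intro o ho hF
  obtain ⟨τ, rfl, -, hτ⟩ := h σ rfl rfl hb o ho
  exact hF τ rfl (hQ _ _ hτ)

/-- Once a good g has been drawn, the rest of the trial succeeds with certainty, whichever strings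
the black box returns; only the sampling can fail. -/
theorem toOuterMeasure_failed_attempt_le (hE : 0 < E) {σ : BBState X.Codes}
    (h : Prepared E M s t σ.num fun i => X.proj (σ.str i))
    (hb : (BBProgram.seq (.sample (.lit 4)) attempt).coef * ((E.size + 1) * X.timeUnit E) ≤
      σ.budget) :
    (X.exec (.seq (.sample (.lit 4)) attempt) σ).toOuterMeasure (X.Failed s t 3) ≤
      (X.sample.map X.proj).toOuterMeasure
        {g | ¬ (IsCommutingInvolution s t g ∨ IsCommutingInvolution s t (candidate M s t g))} := by
  rw [BBProgram.coef, add_mul] at hb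
  have hc : (NumExpr.lit 4).cost σ.num + X.sampleTime ≤
      (BBProgram.sample (.lit 4)).coef * ((E.size + 1) * X.timeUnit E) := by
    rw [BBProgram.coef]
    have h1 := time_le_timeUnit (X := X) (E := E) (K := E.size)
    have h2 := cost_le_timeUnit (X := X) (K := E.size) h.1 (.lit 4)
    nlinarith
  rw [exec, BBState.andThen, exec, BBState.spend, if_pos (by omega), PMF.bind_map,
    PMF.toOuterMeasure_bind_apply, PMF.toOuterMeasure_map_apply, PMF.toOuterMeasure_apply]
  refine ENNReal.tsum_le_tsum fun x => ?_
  by_cases hx : IsCommutingInvolution s t (X.proj x) ∨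
      IsCommutingInvolution s t (candidate M s t (X.proj x))
  · refine le_of_eq_of_le ?_ zero_le
    convert mul_zero (X.sample x)
    have h' : Prepared E M s t σ.num
        (Function.update (fun i => X.proj (σ.str i)) 4 (X.proj x)) := by
      obtain ⟨h1, h2, h3, h4, h5⟩ := h
      exact ⟨h1, h2, by simpa using h3, by simpa using h4, by simpa using h5⟩
    refine toOuterMeasure_failed_eq_zero (E := E) (K := E.size) (runs_attempt hE (M := M) ?_) ?_
      fun n v hnv => hnv.2 (Or.inr ?_)
    · simpa only [BBState.setStr, proj_update_str, NumExpr.eval] using h'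
    · simp only [BBState.setStr]
      omega
    · simpa [BBState.setStr, NumExpr.eval] using hx
  · rw [Set.indicator_of_mem (by exact hx)]
    exact mul_le_of_le_one_right zero_le (PMF.toOuterMeasure_apply_le_one _ _)

/-- A trial leaves the machine prepared again, so the bound ε applies afresh after every failure;
after a success, cell `3` stays correct. -/
theorem toOuterMeasure_failed_attempts_le (hE : 0 < E) {ε : ℝ≥0∞}
    (hε : (X.sample.map X.proj).toOuterMeasure
        {g | ¬ (IsCommutingInvolution s t g ∨ IsCommutingInvolution s t (candidate M s t g))} ≤ ε)
    (k : ℕ) : ∀ σ : BBState X.Codes, Prepared E M s t σ.num (fun i => X.proj (σ.str i)) →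
      (attempts k).coef * ((E.size + 1) * X.timeUnit E) ≤ σ.budget →
      (X.exec (attempts k) σ).toOuterMeasure (X.Failed s t 3) ≤ ε ^ k := by
  induction k with
  | zero => intro σ _ _; rw [pow_zero]; exact PMF.toOuterMeasure_apply_le_one _ _
  | succ k ih =>
    intro σ hσ hb
    rw [attempts, BBProgram.coef, add_mul] at hb
    rw [attempts, pow_succ']
    have hrun : X.Runs E E.size (.seq (.sample (.lit 4)) attempt) σ.num
        (fun i => X.proj (σ.str i)) fun n v => Prepared E M s t n v := by
      refine Runs.seq (Runs.sample hσ.1 fun g => ?_)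
      refine (runs_attempt hE (M := M) (s := s) (t := t) ?_).imp fun n v h => h.1
      obtain ⟨h1, h2, h3, h4, h5⟩ := hσ
      exact ⟨h1, h2, by simpa [NumExpr.eval] using h3, by simpa [NumExpr.eval] using h4,
        by simpa [NumExpr.eval] using h5⟩
    refine (toOuterMeasure_exec_seq_le (S := X.Failed s t 3) (ε := ε ^ k) ?_ ?_).trans ?_
    · intro o ho _
      obtain ⟨τ, rfl, hτb, hτ⟩ := hrun σ rfl rfl (by omega) o ho
      exact ih τ hτ (by omega)
    · intro o ho hS
      obtain ⟨τ, rfl, hτb, hτ⟩ := hrun σ rfl rfl (by omega) o ho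
      simp only [Failed, Set.mem_ofPred_eq, not_forall, not_not] at hS
      obtain ⟨τ', hτ', hC⟩ := hS
      obtain rfl := Option.some_injective _ hτ'
      exact toOuterMeasure_failed_eq_zero (runs_attempts hE k hτ) (by omega)
        fun n v h => h.2 hC
    · gcongr
      exact (toOuterMeasure_failed_attempt_le hE hσ (by omega)).trans hε

theorem runs_findCommutingInvolution {n : ℕ → ℕ} {v : ℕ → G} (k : ℕ) (hn : ∀ i, n i ≤ E)
    (hE : n 0 = E) (hE0 : 0 < E) (h1 : v 0 * v 0 = 1) :
    X.Runs E E.size (findCommutingInvolution k) n v fun _ _ => True := by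
  refine Runs.seq ((runs_prepare hn hE hE0 h1).imp ?_)
  rintro n' v' ⟨M, -, hP, -⟩
  exact Runs.seq ((runs_attempts hE0 k hP).imp fun n'' v'' h => Runs.mul h.1.1 trivial)

theorem toOuterMeasure_failed_findCommutingInvolution_le (hE : 0 < E) {ε : ℝ≥0∞} (k : ℕ)
    {σ : BBState X.Codes} (hn : ∀ i, σ.num i ≤ E) (hn0 : σ.num 0 = E) (hs : X.proj (σ.str 0) = s)
    (ht : X.proj (σ.str 1) = t) (hs2 : s * s = 1)
    (hb : (findCommutingInvolution k).coef * ((E.size + 1) * X.timeUnit E) ≤ σ.budget)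
    (hε : ∀ M, (∃ k m, Odd m ∧ 2 ^ k * m = E ∧ 2 * M = m + 1) →
      IsCommutingInvolution s t (s * t) ∨ IsCommutingInvolution s t ((s * t) * (s * t)) ∨
      (X.sample.map X.proj).toOuterMeasure {g |
        ¬ (IsCommutingInvolution s t g ∨ IsCommutingInvolution s t (candidate M s t g))} ≤ ε) :
    (X.exec (findCommutingInvolution k) σ).toOuterMeasure (X.Failed s t 0) ≤ ε ^ k := by
  rw [findCommutingInvolution, BBProgram.coef, BBProgram.coef,
    add_mul prepare.coef, add_mul (attempts k).coef] at hb
  rw [findCommutingInvolution]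
  have hprep := runs_prepare (X := X) hn hn0 hE (v := fun i => X.proj (σ.str i))
    (by simp only [hs]; exact hs2)
  simp only [hs, ht] at hprep
  -- The bound holds after every possible outcome of the preparation, so its distribution is
  -- irrelevant.
  refine (toOuterMeasure_exec_seq_le (S := Set.univ) (ε := ε ^ k) ?_
    fun o _ h => absurd (Set.mem_univ o) h).trans
    (mul_le_of_le_one_left zero_le (PMF.toOuterMeasure_apply_le_one _ _))
  intro o ho _
  obtain ⟨τ, rfl, hτb, M, hkm, hP, hC⟩ := hprep σ rfl rfl (by omega) o ho
  have hatt := runs_attempts (X := X) hE k hP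
  have hlast : ∀ n v, Prepared E M s t n v → IsCommutingInvolution s t (v 3) →
      X.Runs E E.size (mulCells 0 3 2) n v fun _ v' => IsCommutingInvolution s t (v' 0) :=
    fun n v hP hC => Runs.mul hP.1 (by simpa [NumExpr.eval, hP.2.2.2.2] using hC)
  have hstep : (X.exec (.seq (attempts k) (mulCells 0 3 2)) τ).toOuterMeasure (X.Failed s t 0) ≤
      (X.exec (attempts k) τ).toOuterMeasure (X.Failed s t 3) * 1 := by
    refine toOuterMeasure_exec_seq_le
      (fun o _ _ => PMF.toOuterMeasure_apply_le_one _ _) fun o ho hS => ?_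
    obtain ⟨τ', rfl, hτb', hP', -⟩ := hatt τ rfl rfl (by omega) o ho
    simp only [Failed, Set.mem_ofPred_eq, not_forall, not_not] at hS
    obtain ⟨τ'', hτ'', hC'⟩ := hS
    obtain rfl := Option.some_injective _ hτ''
    exact toOuterMeasure_failed_eq_zero (hlast _ _ hP' hC') (by omega) fun n v h => h
  rw [mul_one] at hstep
  refine hstep.trans ?_
  by_cases hst : IsCommutingInvolution s t (s * t) ∨
      IsCommutingInvolution s t ((s * t) * (s * t))
  · rw [toOuterMeasure_failed_eq_zero (s := s) (t := t) hatt (by omega) fun n v h => h.2 (hC hst)]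
    exact zero_le
  · have hst' := hε M hkm
    rw [← or_assoc] at hst'
    exact toOuterMeasure_failed_attempts_le hE (hst'.resolve_left hst) k τ hP (by omega)

end BlackBoxGroup

/-! ### The main theorem. -/

theorem mainTheorem6 :
    ∃ (p : BBProgram) (P : Polynomial ℕ),
      ∀ (F : Type*) [Field F] [Finite F], Odd (ringChar F) → 9 < Nat.card F →
      ∀ (X : BlackBoxGroup (SO3 F)) (E : ℕ), 0 < E → (∀ x : X.Codes, X.proj x ^ E = 1) →
      ∀ s t : X.Codes, orderOf (X.proj s) = 2 → orderOf (X.proj t) = 2 →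
        X.proj s ≠ X.proj t → ¬ SO3.IsUnipotent (X.proj s * X.proj t) →
        (∃! j : SO3 F, IsCommutingInvolution (X.proj s) (X.proj t) j) ∧
        ∀ inp : ℕ → X.Codes, inp 0 = s → inp 1 = t → ∀ T : ℕ,
          T = P.eval (Nat.log 2 E) * (1 + X.opTime + X.sampleTime) →
          none ∉ (X.output p E inp T).support ∧
          2 / 3 ≤ (X.output p E inp T).toOuterMeasure
            {o | ∃ x : X.Codes, o = some x ∧
              IsCommutingInvolution (X.proj s) (X.proj t) (X.proj x)} := by
  -- The failure bound for one trial at density 2⁻²⁰ depends on neither the field nor the black box,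
  -- so a fixed number k of trials serves for all inputs.
  set ε : ℝ≥0∞ := 1 - ENNReal.ofReal (1 / (2 * ((2 ^ 20 : ℕ) : ℝ))) with hε
  have hε1 : ε < 1 := by
    refine ENNReal.sub_lt_self ENNReal.one_ne_top one_ne_zero ?_
    rw [ne_eq, ENNReal.ofReal_eq_zero, not_le]
    positivity
  obtain ⟨k, hk⟩ : ∃ k, ε ^ k < 1 / 3 :=
    ((ENNReal.tendsto_pow_atTop_nhds_zero_of_lt_one hε1).eventually
      (gt_mem_nhds (by simp))).exists
  refine ⟨BBProgram.findCommutingInvolution k,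
    -- The bit length of E plus one is at most log₂ E + 2. Two of the factors come from the
    -- arithmetic in the time unit, the third from the number of loop passes.
    Polynomial.C (BBProgram.findCommutingInvolution k).coef * (Polynomial.X + 2) ^ 3, ?_⟩
  intro F _ _ hodd _ X E hE hexp s t hs ht hst hun
  have h2 : (2 : F) ≠ 0 := Ring.two_ne_zero fun h => by rw [h] at hodd; exact absurd hodd (by decide)
  refine ⟨existsUnique_isCommutingInvolution h2 hs ht hun, ?_⟩
  rintro inp rfl rfl T rfl
  set σ : BBState X.Codes := ⟨Function.update (fun _ => 0) 0 E, inp,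
    (Polynomial.C (BBProgram.findCommutingInvolution k).coef * (Polynomial.X + 2) ^ 3).eval
      (Nat.log 2 E) * (1 + X.opTime + X.sampleTime)⟩ with hσ
  have hn : ∀ i, σ.num i ≤ E := BlackBoxGroup.update_le (fun _ => Nat.zero_le E) le_rfl
  have hn0 : σ.num 0 = E := by simp [hσ]
  have hs2 : X.proj (inp 0) * X.proj (inp 0) = 1 := by rw [← sq, ← hs, pow_orderOf_eq_one]
  have hb : (BBProgram.findCommutingInvolution k).coef * ((E.size + 1) * X.timeUnit E) ≤
      σ.budget := by
    have hsize : E.size + 1 ≤ Nat.log 2 E + 2 := by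
      have := Nat.size_le.2 (Nat.lt_pow_succ_log_self one_lt_two E)
      omega
    simp only [hσ, BlackBoxGroup.timeUnit, Polynomial.eval_mul, Polynomial.eval_C,
      Polynomial.eval_pow, Polynomial.eval_add, Polynomial.eval_X, Polynomial.eval_ofNat]
    calc (BBProgram.findCommutingInvolution k).coef *
          ((E.size + 1) * ((E.size + 1) ^ 2 * (1 + X.opTime + X.sampleTime)))
        = (BBProgram.findCommutingInvolution k).coef * (E.size + 1) ^ 3 *
          (1 + X.opTime + X.sampleTime) := by ring
      _ ≤ _ := by gcongr
  constructor
  · intro hnone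
    rw [BlackBoxGroup.output, PMF.support_map] at hnone
    obtain ⟨o, ho, hon⟩ := hnone
    obtain ⟨τ, rfl, -⟩ := BlackBoxGroup.runs_findCommutingInvolution k hn hn0 hE
      (v := fun i => X.proj (inp i)) hs2 σ rfl rfl hb o ho
    simp at hon
  · have hfail := BlackBoxGroup.toOuterMeasure_failed_findCommutingInvolution_le (X := X) hE
      (ε := ε) (s := X.proj (inp 0)) (t := X.proj (inp 1)) k hn hn0 rfl rfl hs2 hb (by
        intro M hM
        by_contra hcon
        rw [not_or, not_or, not_le] at hcon
        refine absurd (X.toOuterMeasure_map_sample_le (by positivity)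
          (card_SO3_le_mul_card_success h2 hs ht hst hun hcon.1 hcon.2.1 (M := M) ?_))
          (not_le.2 hcon.2.2)
        intro x hx
        -- The exponent is known only for encrypted elements, but near-uniform sampling implies that
        -- every group element is encrypted.
        obtain ⟨y, rfl⟩ := X.proj_surjective x
        exact pow_eq_self_of_odd_orderOf (hexp y) hx hM)
    rw [BlackBoxGroup.output, PMF.toOuterMeasure_map_apply]
    have hadd := (X.exec (BBProgram.findCommutingInvolution k) σ).toOuterMeasure_add_compl
      (X.Failed (X.proj (inp 0)) (X.proj (inp 1)) 0)ᶜ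
    rw [compl_compl] at hadd
    have hsub : (X.Failed (X.proj (inp 0)) (X.proj (inp 1)) 0)ᶜ ⊆
        (Option.map fun σ : BBState X.Codes => σ.str 0) ⁻¹' {o | ∃ x : X.Codes, o = some x ∧
              IsCommutingInvolution (X.proj (inp 0)) (X.proj (inp 1)) (X.proj x)} := by
      intro o ho
      simp only [BlackBoxGroup.Failed, Set.mem_compl_iff, Set.mem_ofPred_eq, not_forall,
        not_not] at ho
      obtain ⟨τ, rfl, hC⟩ := ho
      exact ⟨τ.str 0, rfl, hC⟩
    refine le_trans ?_ (MeasureTheory.measure_mono hsub)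
    have h13 : (2 / 3 : ℝ≥0∞) + 1 / 3 = 1 := by
      rw [← ENNReal.add_div]
      norm_num
      exact ENNReal.div_self (by norm_num) (by norm_num)
    have h3 : (1 / 3 : ℝ≥0∞) ≠ ⊤ := by simp
    refine (ENNReal.add_le_add_iff_right h3).1 ?_
    rw [h13]
    exact hadd.symm.le.trans (add_le_add le_rfl (hfail.trans hk.le))
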